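/- **Setting.** Let $\mathbb H_1=\mathbb R^3$ be the Heisenberg group with law $(a,b,c)(a',b',c')=(a+a',b+b',c+c'+ab')$, let $\Gamma=\{(a,b,c): a,b,c\in\mathbb Z\}$ and $M=\Gamma\backslash\mathbb H_1$, with elements $\dot x=\Gamma x$, equipped with the invariant measure that is $da\,db\,dc$ on the fundamental domain $[0,1)^3$. A function on $M$ is smooth if its $\Gamma$-periodic lift to $\mathbb H_1\cong\mathbb R^3$ is smooth. Let $R(g)f(\dot x)=f(\dot x g)$ be the right regular representation of $\mathbb H_1$ on $L^2(M)$, and for real $\lambda\ne0$ let $\pi_\lambda(a,b,c)h(u)=e^{2\pi i\lambda(c+ub)}h(u+a)$ be the Schrödinger representation on $L^2(\mathbb R)$. For $\lambda\in\mathbb Z$ let $$L^2_\lambda(M)=\{f\in L^2(M): f(\Gamma(a,b,c))=f(\Gamma(a,b,0))\,e^{2\pi i\lambda c}\},$$ where the identity is required for all $(a,b,c)$ for some representative of the class $f$. **Theorem.** The spaces $L^2_\lambda(M)$ are closed and $R$-invariant, and $L^2(M)=\bigoplus^\perp_{\lambda\in\mathbb Z}L^2_\lambda(M)$ (orthogonal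 Hilbert sum). Every $f\in L^2(M)$ is the $L^2$-convergent sum $f=\sum_{\lambda\in\mathbb Z} f_\lambda$ with $f_\lambda\in L^2_\lambda(M)$ given for almost every $(a,b,c)$ by $f_\lambda(\Gamma(a,b,c))=e^{2\pi i\lambda c}\int_0^1 f(\Gamma(a,b,t))e^{-2\pi i\lambda t}\,dt$. 1. For $\omega\in\mathbb Z^2$ the formula $\chi_\omega(\Gamma(a,b,c))=e^{2\pi i(\omega_1a+\omega_2b)}$ gives a well defined smooth function on $M$, and $L^2_0(M)=\bigoplus^\perp_{\omega\in\mathbb Z^2}\mathbb C\chi_\omega$, where each $\mathbb C\chi_\omega$ is $R$-invariant and irreducible. 2. Let $\lambda\in\mathbb Z\setminus\{0\}$. For $h\in\mathcal S(\mathbb R)$, $q\in\mathbb Z$ and $x=(a,b,c)$ put $$\mathrm{BWZ}_{\lambda,q}(h)(\dot x)=\frac{\sqrt{|\lambda|}}{\lambda}\sum_{k\in\mathbb Z}e^{-2\pi i qk/\lambda}\,e^{2\pi i(\lambda c+kb)}\,h\!\left(\tfrac k\lambda+a\right).$$ (a) The series converges absolutely, $\mathrm{BWZ}_{\lambda,q}(h)$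 is a well defined smooth function on $M$ which belongs to $L^2_\lambda(M)$, and $\mathrm{BWZ}_{\lambda,\lambda k_1+q}(h)=\mathrm{BWZ}_{\lambda,q}(h)$ for all $k_1\in\mathbb Z$; so $q$ may be taken in $\mathbb Z/\lambda\mathbb Z$. (b) For each $q\in\mathbb Z/\lambda\mathbb Z$, $\mathrm{BWZ}_{\lambda,q}$ extends uniquely, among bounded linear maps from $L^2(\mathbb R)$ to $L^2(M)$, to a linear isometry $\mathrm{BWZ}_{\lambda,q}:L^2(\mathbb R)\to L^2(M)$ with values in $L^2_\lambda(M)$ (that is, a unitary map onto its range). (c) For all $q_0,q\in\mathbb Z$ and $\dot x=\Gamma(a,b,c)$, $$\mathrm{BWZ}_{\lambda,q_0}(h)\big(\dot x(\tfrac q\lambda,0,0)\big)=e^{-2\pi i qb}e^{2\pi i q_0q/\lambda}\,\mathrm{BWZ}_{\lambda,q_0}(h)(\dot x),\qquad \mathrm{BWZ}_{\lambda,q_0}(h)\big(\dot x(0,\tfrac q\lambda,0)\big)=e^{2\pi i qa}\,\mathrm{BWZ}_{\lambda,q_0-q}(h)(\dot x),$$ everywhere for $h\in\mathcal S(\mathbb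 R)$, and for almost every $(a,b,c)$ for $h\in L^2(\mathbb R)$. 3. Let $\lambda\in\mathbb Z\setminus\{0\}$. The subspaces $L^2_{\lambda,q}(M)=\mathrm{BWZ}_{\lambda,q}(L^2(\mathbb R))$, $q\in\mathbb Z/\lambda\mathbb Z$, are closed and $R$-invariant, and $L^2_\lambda(M)=\bigoplus^\perp_{q\in\mathbb Z/\lambda\mathbb Z}L^2_{\lambda,q}(M)$. Moreover $\pi_\lambda$ is irreducible, and $\mathrm{BWZ}_{\lambda,q}\,\pi_\lambda(g)=R(g)\,\mathrm{BWZ}_{\lambda,q}$ for all $g\in\mathbb H_1$, so that $R$ restricted to $L^2_{\lambda,q}(M)$ is unitarily equivalent to $\pi_\lambda$ with intertwiner $\mathrm{BWZ}_{\lambda,q}$. -/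

import Mathlib

open MeasureTheory
open scoped SchwartzMap ContDiff ENNReal

noncomputable section

namespace HeisNil

/-! ## The Heisenberg group -/

/-- The Heisenberg group, realised as `ℝ³` with coordinates `(a, b, c)`. -/
@[ext]
structure Heis where
  a : ℝ
  b : ℝ
  c : ℝ

namespace Heis

instance : Mul Heis := ⟨fun x y => ⟨x.a + y.a, x.b + y.b, x.c + y.c + x.a * y.b⟩⟩
instance : One Heis := ⟨⟨0, 0, 0⟩⟩
instance : Inv Heis := ⟨fun x => ⟨-x.a, -x.b, -x.c + x.a * x.b⟩⟩

@[simp] theorem mul_a (x y : Heis) : (x * y).a = x.a + y.a := rfl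
@[simp] theorem mul_b (x y : Heis) : (x * y).b = x.b + y.b := rfl
@[simp] theorem mul_c (x y : Heis) : (x * y).c = x.c + y.c + x.a * y.b := rfl
@[simp] theorem one_a : (1 : Heis).a = 0 := rfl
@[simp] theorem one_b : (1 : Heis).b = 0 := rfl
@[simp] theorem one_c : (1 : Heis).c = 0 := rfl
@[simp] theorem inv_a (x : Heis) : (x⁻¹).a = -x.a := rfl
@[simp] theorem inv_b (x : Heis) : (x⁻¹).b = -x.b := rfl
@[simp] theorem inv_c (x : Heis) : (x⁻¹).c = -x.c + x.a * x.b := rfl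

instance : Group Heis :=
  Group.ofLeftAxioms
    (fun x y z => by ext <;> simp <;> ring)
    (fun x => by ext <;> simp)
    (fun x => by ext <;> simp)

/-- The identification of the Heisenberg group with `ℝ × ℝ × ℝ`. -/
def equivProd : Heis ≃ ℝ × ℝ × ℝ where
  toFun x := (x.a, x.b, x.c)
  invFun p := ⟨p.1, p.2.1, p.2.2⟩
  left_inv _ := rfl
  right_inv _ := rfl

/-- The point `(a, b, c)` of the Heisenberg group attached to a triple of reals. -/
def ofProd (p : ℝ × ℝ × ℝ) : Heis := ⟨p.1, p.2.1, p.2.2⟩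

/-- The Borel structure, transported from `ℝ × ℝ × ℝ`. -/
instance : MeasurableSpace Heis := MeasurableSpace.comap equivProd inferInstance

theorem measurable_equivProd : Measurable equivProd := comap_measurable _

theorem measurable_ofProd : Measurable ofProd := by
  rintro s ⟨t, ht, rfl⟩
  exact ht

theorem measurable_to {X : Type*} [MeasurableSpace X] {f : X → Heis}
    (ha : Measurable fun x => (f x).a) (hb : Measurable fun x => (f x).b)
    (hc : Measurable fun x => (f x).c) : Measurable f :=
  measurable_ofProd.comp (ha.prodMk (hb.prodMk hc))

theorem measurable_a : Measurable Heis.a := measurable_equivProd.fst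
theorem measurable_b : Measurable Heis.b := measurable_equivProd.snd.fst
theorem measurable_c : Measurable Heis.c := measurable_equivProd.snd.snd

/-- The Haar measure `da db dc`. -/
def haar : Measure Heis := (volume : Measure (ℝ × ℝ × ℝ)).map ofProd

theorem mp_ofProd : MeasurePreserving ofProd volume haar := ⟨measurable_ofProd, rfl⟩

theorem mp_equivProd : MeasurePreserving equivProd haar volume := by
  refine ⟨measurable_equivProd, ?_⟩
  rw [haar, Measure.map_map measurable_equivProd measurable_ofProd]
  exact Measure.map_id

/-- Left translations preserve `da db dc`. -/
theorem mp_mul_left (g : Heis) : MeasurePreserving (fun x => g * x) haar haar := by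
  have h : MeasurePreserving
      (fun p : ℝ × ℝ × ℝ => (g.a + p.1, (g.b + p.2.1, (g.c + g.a * p.2.1) + p.2.2)))
      volume volume := by
    refine (measurePreserving_add_left volume g.a).prod
      (MeasurePreserving.skew_product (μa := (volume : Measure ℝ)) (μb := volume)
        (μc := (volume : Measure ℝ)) (μd := volume) (measurePreserving_add_left volume g.b)
        (g := fun b c => (g.c + g.a * b) + c) ?_ ?_)
    · unfold Function.uncurry; fun_prop
    · exact Filter.Eventually.of_forall fun b =>
        (measurePreserving_add_left volume (g.c + g.a * b)).map_eq
  have h2 := (mp_ofProd.comp h).comp mp_equivProd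
  convert h2 using 1
  funext x
  ext <;> simp [ofProd, equivProd]
  ring

/-- Right translations preserve `da db dc`. -/
theorem mp_mul_right (g : Heis) : MeasurePreserving (fun x => x * g) haar haar := by
  have h : MeasurePreserving
      (fun p : ℝ × ℝ × ℝ => (p.1 + g.a, (p.2.1 + g.b, p.2.2 + (g.c + p.1 * g.b))))
      volume volume := by
    refine MeasurePreserving.skew_product (μa := (volume : Measure ℝ)) (μb := volume)
        (μc := (volume : Measure (ℝ × ℝ))) (μd := volume) (measurePreserving_add_right volume g.a)
        (g := fun a p => (p.1 + g.b, p.2 + (g.c + a * g.b))) ?_ ?_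
    · unfold Function.uncurry; fun_prop
    · exact Filter.Eventually.of_forall fun a =>
        ((measurePreserving_add_right volume g.b).prod
          (measurePreserving_add_right volume (g.c + a * g.b))).map_eq
  have h2 := (mp_ofProd.comp h).comp mp_equivProd
  convert h2 using 1
  funext x
  ext <;> simp [ofProd, equivProd]
  ring

end Heis

/-! ## The nilmanifold `M = Γ \ ℍ₁` -/

/-- The discrete subgroup `Γ` of points with integer coordinates. -/
def Gamma : Subgroup Heis where
  carrier := {x | ∃ m n p : ℤ, x = ⟨m, n, p⟩}
  mul_mem' := by
    rintro _ _ ⟨m, n, p, rfl⟩ ⟨m', n', p', rfl⟩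
    exact ⟨m + m', n + n', p + p' + m * n', by ext <;> simp⟩
  one_mem' := ⟨0, 0, 0, by ext <;> simp⟩
  inv_mem' := by
    rintro _ ⟨m, n, p, rfl⟩
    exact ⟨-m, -n, -p + m * n, by ext <;> simp⟩

/-- `M = Γ \ ℍ₁`, the space of right cosets `Γ x`. -/
def M : Type := Quotient (QuotientGroup.rightRel Gamma)

/-- The projection `x ↦ ẋ = Γ x`. -/
def mk (x : Heis) : M := Quotient.mk (QuotientGroup.rightRel Gamma) x

theorem mk_eq_mk {x y : Heis} : mk x = mk y ↔ y * x⁻¹ ∈ Gamma :=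
  Quotient.eq.trans QuotientGroup.rightRel_apply

/-- The right action `ẋ ↦ ẋ g` of the Heisenberg group on `M`. -/
def rmul (g : Heis) (m : M) : M :=
  Quotient.map (fun x => x * g)
    (fun x y h => by
      have h' : y * x⁻¹ ∈ Gamma := QuotientGroup.rightRel_apply.1 h
      exact QuotientGroup.rightRel_apply.2 (by simpa [mul_assoc] using h')) m

@[simp] theorem rmul_mk (g x : Heis) : rmul g (mk x) = mk (x * g) := rfl

theorem mk_surjective : Function.Surjective mk := Quotient.mk_surjective

/-- The quotient (Borel) structure on `M`. -/
instance : MeasurableSpace M := MeasurableSpace.map mk inferInstance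

theorem measurable_mk : Measurable mk := fun _ h => h

/-- The fundamental domain `[0,1)³`. -/
def cube : Set Heis :=
  {x | x.a ∈ Set.Ico (0 : ℝ) 1 ∧ x.b ∈ Set.Ico (0 : ℝ) 1 ∧ x.c ∈ Set.Ico (0 : ℝ) 1}

/-- The invariant measure `dẋ` on `M`, which is `da db dc` on the fundamental domain `[0,1)³`. -/
def muM : Measure M := (Heis.haar.restrict cube).map mk

theorem measurableSet_cube : MeasurableSet cube :=
  ((Heis.measurable_a measurableSet_Ico).inter
    ((Heis.measurable_b measurableSet_Ico).inter (Heis.measurable_c measurableSet_Ico)))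

instance : Countable Gamma := by
  have : Function.Surjective (fun t : ℤ × ℤ × ℤ =>
      (⟨⟨t.1, t.2.1, t.2.2⟩, t.1, t.2.1, t.2.2, rfl⟩ : Gamma)) := by
    rintro ⟨_, m, n, p, rfl⟩
    exact ⟨(m, n, p), rfl⟩
  exact this.countable

instance : MeasurableConstSMul Gamma Heis :=
  ⟨fun g => (Heis.mp_mul_left (g : Heis)).measurable⟩

instance : SMulInvariantMeasure Gamma Heis Heis.haar :=
  ⟨fun g _ hs => (Heis.mp_mul_left (g : Heis)).measure_preimage hs.nullMeasurableSet⟩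

theorem isFundamentalDomain_cube : IsFundamentalDomain Gamma cube Heis.haar := by
  refine IsFundamentalDomain.mk' measurableSet_cube.nullMeasurableSet fun x => ?_
  refine ⟨⟨⟨(-⌊x.a⌋ : ℤ), (-⌊x.b⌋ : ℤ), (-⌊x.c + (-⌊x.a⌋ : ℤ) * x.b⌋ : ℤ)⟩, _, _, _, rfl⟩,
    ?_, ?_⟩
  · have h (t : ℝ) : ((-⌊t⌋ : ℤ) : ℝ) + t ∈ Set.Ico (0 : ℝ) 1 := by
      push_cast
      constructor
      · linarith [Int.floor_le t]
      · linarith [Int.lt_floor_add_one t]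
    refine ⟨h _, h _, ?_⟩
    have := h (x.c + (-⌊x.a⌋ : ℤ) * x.b)
    rw [← add_assoc] at this
    exact this
  · rintro ⟨_, m, n, p, rfl⟩ ⟨ha, hb, hc⟩
    have key (k : ℤ) (t : ℝ) (h : (k : ℝ) + t ∈ Set.Ico (0 : ℝ) 1) : k = -⌊t⌋ := by
      have : ⌊t⌋ = -k := by
        rw [Int.floor_eq_iff]
        push_cast
        constructor <;> linarith [h.1, h.2]
      omega
    have ea := key m x.a ha
    have eb := key n x.b hb
    subst ea eb
    have ec := key p (x.c + (-⌊x.a⌋ : ℤ) * x.b) (by rw [← add_assoc]; exact hc)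
    subst ec
    rfl

/-- Right translations preserve `dẋ`. -/
theorem mp_rmul (g : Heis) : MeasurePreserving (rmul g) muM muM := by
  have hm : Measurable (rmul g) := fun s hs =>
    (Heis.mp_mul_right g).measurable (measurable_mk hs)
  refine ⟨hm, Measure.ext fun s hs => ?_⟩
  have hA := measurable_mk hs
  rw [Measure.map_apply hm hs, muM, Measure.map_apply measurable_mk (hm hs),
    Measure.map_apply measurable_mk hs, Measure.restrict_apply hA,
    Measure.restrict_apply (measurable_mk (hm hs))]
  have hF : IsFundamentalDomain Gamma ((fun x => x * g⁻¹) ⁻¹' cube) Heis.haar :=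
    isFundamentalDomain_cube.preimage_of_equiv
      (Heis.mp_mul_right g⁻¹).quasiMeasurePreserving (e := id) Function.bijective_id
      (fun γ x => mul_assoc (γ : Heis) x g⁻¹)
  have h1 : mk ⁻¹' (rmul g ⁻¹' s) ∩ cube
      = (fun x => x * g) ⁻¹' (mk ⁻¹' s ∩ (fun x => x * g⁻¹) ⁻¹' cube) := by
    ext x
    simp
  rw [h1, (Heis.mp_mul_right g).measure_preimage
    (hA.inter ((Heis.mp_mul_right g⁻¹).measurable measurableSet_cube)).nullMeasurableSet]
  refine hF.measure_set_eq isFundamentalDomain_cube hA fun γ => ?_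
  ext x
  have : mk (γ • x) = mk x :=
    mk_eq_mk.2 (by
      have : x * ((γ : Heis) * x)⁻¹ = (γ : Heis)⁻¹ := by group
      change x * ((γ : Heis) * x)⁻¹ ∈ Gamma
      rw [this]
      exact Gamma.inv_mem γ.2)
  simp [this]

/-- `f` is a smooth function on `M`: its `Γ`-periodic lift is smooth on `ℍ₁ = ℝ³`. -/
def SmoothOnM (f : M → ℂ) : Prop :=
  ContDiff ℝ ∞ fun p : ℝ × ℝ × ℝ => f (mk (Heis.ofProd p))

/-- The function on `M` obtained by evaluating `φ` at a representative. When `φ` is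
`Γ`-periodic this is the function `ẋ ↦ φ x`. -/
def onM (φ : Heis → ℂ) : M → ℂ := fun m => φ (Quotient.out m)

/-- `φ` is `Γ`-periodic, i.e. it descends to a well defined function on `M`. -/
def IsPeriodic (φ : Heis → ℂ) : Prop := ∀ γ ∈ Gamma, ∀ x, φ (γ * x) = φ x

/-! ## The spaces `L²(M)`, `L²(ℝ)` and the unitary representations -/

/-- The Hilbert space `L²(M)`. -/
abbrev L2M : Type := Lp ℂ 2 muM

/-- The Hilbert space `L²(ℝ)`. -/
abbrev L2R : Type := Lp ℂ 2 (volume : Measure ℝ)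

/-- The right regular representation `R(g) f (ẋ) = f (ẋ g)` on `L²(M)`, as a homomorphism into
the unitary group. -/
def regRep : Heis →* (L2M ≃ₗᵢ[ℂ] L2M) :=
  let U (g : Heis) : L2M →ₗᵢ[ℂ] L2M := Lp.compMeasurePreservingₗᵢ ℂ (rmul g) (mp_rmul g)
  have hmul (g g' : Heis) (f : L2M) : U (g * g') f = U g (U g' f) := by
    refine Lp.ext ?_
    refine (Lp.coeFn_compMeasurePreserving f (mp_rmul (g * g'))).trans ?_
    refine .trans ?_ (Lp.coeFn_compMeasurePreserving (U g' f) (mp_rmul g)).symm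
    refine .trans ?_ ((mp_rmul g).quasiMeasurePreserving.ae_eq_comp
      (Lp.coeFn_compMeasurePreserving f (mp_rmul g')).symm)
    refine .of_eq (funext fun m => ?_)
    obtain ⟨x, rfl⟩ := mk_surjective m
    simp [mul_assoc]
  have hone (f : L2M) : U 1 f = f := by
    refine Lp.ext ((Lp.coeFn_compMeasurePreserving f (mp_rmul 1)).trans ?_)
    refine .of_eq (funext fun m => ?_)
    obtain ⟨x, rfl⟩ := mk_surjective m
    simp
  { toFun := fun g =>
      { toLinearEquiv := LinearEquiv.ofLinearMap (U g).toLinearMap (U g⁻¹).toLinearMap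
          (LinearMap.ext fun f => by
            change U g (U g⁻¹ f) = f
            rw [← hmul, mul_inv_cancel, hone])
          (LinearMap.ext fun f => by
            change U g⁻¹ (U g f) = f
            rw [← hmul, inv_mul_cancel, hone])
        norm_map' := (U g).norm_map }
    map_one' := LinearIsometryEquiv.ext hone
    map_mul' := fun g g' => LinearIsometryEquiv.ext (hmul g g') }

/-- The defining formula of the right regular representation. -/
theorem coeFn_regRep (g : Heis) (f : L2M) :
    (regRep g f : M → ℂ) =ᵐ[muM] fun m => (f : M → ℂ) (rmul g m) :=
  Lp.coeFn_compMeasurePreserving f (mp_rmul g)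

/-- The factor `e^{2πi l (c + u b)}` of the Schrödinger representation. -/
def phase (l : ℝ) (g : Heis) (u : ℝ) : ℂ :=
  Complex.exp (2 * Real.pi * Complex.I * l * (g.c + u * g.b))

theorem norm_phase (l : ℝ) (g : Heis) (u : ℝ) : ‖phase l g u‖ = 1 := by
  have : phase l g u = Complex.exp (((2 * Real.pi * l * (g.c + u * g.b) : ℝ) : ℂ) * Complex.I) := by
    unfold phase
    push_cast
    ring_nf
  rw [this, Complex.norm_exp_ofReal_mul_I]

theorem memLp_schrodinger (l : ℝ) (g : Heis) (f : L2R) :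
    MemLp (fun u : ℝ => phase l g u * (f : ℝ → ℂ) (u + g.a)) 2 volume := by
  have h := (Lp.memLp f).comp_measurePreserving (measurePreserving_add_right volume g.a)
  refine h.of_le (AEStronglyMeasurable.mul ?_ h.1) (.of_forall fun u => ?_)
  · exact Continuous.aestronglyMeasurable (by unfold phase; fun_prop)
  · simp [norm_phase]

/-- The operator `f ↦ (u ↦ e^{2πi l (c + u b)} f (u + a))` on `L²(ℝ)`. -/
def schrodingerOp (l : ℝ) (g : Heis) : L2R →ₗᵢ[ℂ] L2R where
  toFun f := (memLp_schrodinger l g f).toLp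
  map_add' f f' := by
    rw [← MemLp.toLp_add, MemLp.toLp_eq_toLp_iff]
    filter_upwards [(measurePreserving_add_right volume g.a).quasiMeasurePreserving.ae_eq_comp
      (Lp.coeFn_add f f')] with u hu
    simp only [Function.comp_apply, Pi.add_apply] at hu ⊢
    rw [hu, mul_add]
  map_smul' z f := by
    rw [RingHom.id_apply, ← MemLp.toLp_const_smul, MemLp.toLp_eq_toLp_iff]
    filter_upwards [(measurePreserving_add_right volume g.a).quasiMeasurePreserving.ae_eq_comp
      (Lp.coeFn_smul z f)] with u hu
    simp only [Function.comp_apply, Pi.smul_apply, smul_eq_mul] at hu ⊢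
    rw [hu]
    ring
  norm_map' f := by
    change ‖(memLp_schrodinger l g f).toLp‖ = ‖f‖
    rw [Lp.norm_toLp, Lp.norm_def]
    congr 1
    rw [← eLpNorm_comp_measurePreserving (Lp.aestronglyMeasurable f)
      (measurePreserving_add_right volume g.a)]
    exact eLpNorm_congr_norm_ae (.of_forall fun u => by simp [norm_phase])

theorem coeFn_schrodingerOp (l : ℝ) (g : Heis) (f : L2R) :
    (schrodingerOp l g f : ℝ → ℂ) =ᵐ[volume]
      fun u => phase l g u * (f : ℝ → ℂ) (u + g.a) :=
  (memLp_schrodinger l g f).coeFn_toLp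

theorem schrodingerOp_mul (l : ℝ) (g g' : Heis) (f : L2R) :
    schrodingerOp l (g * g') f = schrodingerOp l g (schrodingerOp l g' f) := by
  refine Lp.ext ?_
  filter_upwards [coeFn_schrodingerOp l (g * g') f,
    coeFn_schrodingerOp l g (schrodingerOp l g' f),
    (measurePreserving_add_right volume g.a).quasiMeasurePreserving.ae_eq_comp
      (coeFn_schrodingerOp l g' f)] with u h1 h2 h3
  simp only [Function.comp_apply] at h3
  rw [h1, h2, h3, ← mul_assoc, Heis.mul_a, add_assoc]
  congr 1
  unfold phase
  rw [← Complex.exp_add]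
  congr 1
  simp only [Heis.mul_c, Heis.mul_b]
  push_cast
  ring

theorem schrodingerOp_one (l : ℝ) (f : L2R) : schrodingerOp l 1 f = f := by
  refine Lp.ext ?_
  filter_upwards [coeFn_schrodingerOp l 1 f] with u h
  rw [h]
  simp [phase]

/-- The Schrödinger representation `π_l (a,b,c) h (u) = e^{2πi l (c + u b)} h (u + a)` on `L²(ℝ)`,
as a homomorphism into the unitary group. -/
def schrodinger (l : ℝ) : Heis →* (L2R ≃ₗᵢ[ℂ] L2R) where
  toFun g :=
    { toLinearEquiv := LinearEquiv.ofLinearMap (schrodingerOp l g).toLinearMap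
        (schrodingerOp l g⁻¹).toLinearMap
        (LinearMap.ext fun f => by
          change schrodingerOp l g (schrodingerOp l g⁻¹ f) = f
          rw [← schrodingerOp_mul, mul_inv_cancel, schrodingerOp_one])
        (LinearMap.ext fun f => by
          change schrodingerOp l g⁻¹ (schrodingerOp l g f) = f
          rw [← schrodingerOp_mul, inv_mul_cancel, schrodingerOp_one])
      norm_map' := (schrodingerOp l g).norm_map }
  map_one' := LinearIsometryEquiv.ext (schrodingerOp_one l)
  map_mul' g g' := LinearIsometryEquiv.ext (schrodingerOp_mul l g g')

/-- The defining formula of the Schrödinger representation. -/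
theorem coeFn_schrodinger (l : ℝ) (g : Heis) (f : L2R) :
    (schrodinger l g f : ℝ → ℂ) =ᵐ[volume]
      fun u => phase l g u * (f : ℝ → ℂ) (u + g.a) :=
  coeFn_schrodingerOp l g f

section Abstract

variable {E : Type*} [NormedAddCommGroup E] [InnerProductSpace ℂ E]

/-- The subspace `V` is stable under the representation `ρ`. -/
def IsInvariant (ρ : Heis →* (E ≃ₗᵢ[ℂ] E)) (V : Submodule ℂ E) : Prop :=
  ∀ g, ∀ f ∈ V, ρ g f ∈ V

/-- `ρ` acts irreducibly on the subspace `V`: `V` is invariant, non-zero, and has no closed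
invariant subspaces except `0` and itself. -/
def IsIrreducibleOn (ρ : Heis →* (E ≃ₗᵢ[ℂ] E)) (V : Submodule ℂ E) : Prop :=
  IsInvariant ρ V ∧ V ≠ ⊥ ∧
    ∀ W : Submodule ℂ E, W ≤ V → IsClosed (W : Set E) → IsInvariant ρ W → W = ⊥ ∨ W = V

/-- `W` is the orthogonal Hilbert direct sum of the closed subspaces `V i`. -/
def IsOrthogonalDecomposition {ι : Type*} (V : ι → Submodule ℂ E) (W : Submodule ℂ E) : Prop :=
  (∀ i, IsClosed (V i : Set E)) ∧
    OrthogonalFamily ℂ (fun i => V i) (fun i => (V i).subtypeₗᵢ) ∧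
    W = (⨆ i, V i).topologicalClosure

end Abstract

/-! ## Central Fourier modes, characters and the Berezin–Weil–Zak transform -/

/-- `L²_l(M)`: the classes in `L²(M)` with a representative `F` such that
`F (Γ(a,b,c)) = F (Γ(a,b,0)) e^{2πi l c}`. -/
def centralMode (l : ℤ) : Submodule ℂ L2M where
  carrier := {f | ∃ F : M → ℂ, (f : M → ℂ) =ᵐ[muM] F ∧ ∀ a b c : ℝ,
    F (mk ⟨a, b, c⟩) = F (mk ⟨a, b, 0⟩) * Complex.exp (2 * Real.pi * Complex.I * l * c)}
  add_mem' := by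
    rintro f f' ⟨F, hF, h⟩ ⟨F', hF', h'⟩
    refine ⟨F + F', (Lp.coeFn_add f f').trans (hF.add hF'), fun a b c => ?_⟩
    simp only [Pi.add_apply]
    rw [h a b c, h' a b c, add_mul]
  zero_mem' := ⟨0, Lp.coeFn_zero _ _ _, by simp⟩
  smul_mem' := by
    rintro z f ⟨F, hF, h⟩
    refine ⟨z • F, (Lp.coeFn_smul z f).trans (hF.const_smul z), fun a b c => ?_⟩
    change z * F _ = z * F _ * _
    rw [h a b c]
    ring

/-- `(a,b,c) ↦ e^{2πi (w₁ a + w₂ b)}` on the Heisenberg group. -/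
def chiLift (w : ℤ × ℤ) (x : Heis) : ℂ :=
  Complex.exp (2 * Real.pi * Complex.I * (w.1 * x.a + w.2 * x.b))

/-- The character `χ_w` on `M`. -/
def chi (w : ℤ × ℤ) : M → ℂ := onM (chiLift w)

/-- The `k`-th term of the series defining the Berezin–Weil–Zak transform at `(a,b,c)`. -/
def bwzTerm (l q : ℤ) (h : 𝓢(ℝ, ℂ)) (x : Heis) (k : ℤ) : ℂ :=
  Complex.exp (-(2 * Real.pi * Complex.I * q * (k / l))) *
    Complex.exp (2 * Real.pi * Complex.I * (l * x.c + k * x.b)) * h ((k : ℝ) / l + x.a)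

/-- The series of the Berezin–Weil–Zak transform, as a function on the Heisenberg group. -/
def bwzLift (l q : ℤ) (h : 𝓢(ℝ, ℂ)) (x : Heis) : ℂ :=
  ((Real.sqrt |(l : ℝ)| / l : ℝ) : ℂ) * ∑' k : ℤ, bwzTerm l q h x k

/-- The Berezin–Weil–Zak transform of a Schwartz function, as a function on `M`. -/
def bwz (l q : ℤ) (h : 𝓢(ℝ, ℂ)) : M → ℂ := onM (bwzLift l q h)

end HeisNil

end

open HeisNil

/-!
The centre of `ℍ₁` acts on `L²(M)` through the circle and multiplies the mode `l` by a character,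
so the modes are pairwise orthogonal, and the projection onto the mode `l` is the `l`-th Fourier
coefficient in the central variable. Up to a null set `M` is the cube `[0,1)³`, hence a torus, and
completeness of the modes is the completeness of the trigonometric system.

In the cube coordinates `(b, c)` the terms of the Brezin–Weil–Zak series are multiples of the
distinct characters `𝐞 (k b + l c)`, with samples of `h` at `k / l + a` as coefficients. Pythagoras
and the unfolding of `∫ |h|²` over `ℝ` into these samples make the transform isometric.
Right translation by `(1/l, 0, 0)` followed by multiplication by `𝐞 b` is unitary on `L²(M)` and
acts on the range with index `q` as the scalar `𝐞 (q / l)`, so different ranges are orthogonal.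
Averaging the series over `q` isolates one residue class of `k` modulo `l`, and by taking `h` with
small support, a single sample; a function in the mode `l` orthogonal to all ranges therefore has
vanishing Fourier coefficients.

If all matrix coefficients of `π_l` at `(f, g)` vanish, then for every `a` the Fourier transform of
`u ↦ conj (f (u + a)) * g u` is zero. By Tonelli `‖f‖ ‖g‖ = 0`, which is irreducibility.
-/

noncomputable section

namespace HeisNil

open scoped FourierTransform

section Hilbert

variable {E : Type*} [NormedAddCommGroup E] [InnerProductSpace ℂ E]

lemma IsOrthogonalDecomposition.of_total [CompleteSpace E] {ι : Type*} {V : ι → Submodule ℂ E}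
    {W : Submodule ℂ E} (hV : ∀ i, IsClosed (V i : Set E)) (hW : IsClosed (W : Set E))
    (hVW : ∀ i, V i ≤ W) (horth : Pairwise fun i j => V i ⟂ V j)
    (htotal : ∀ f ∈ W, (∀ i, f ∈ (V i)ᗮ) → f = 0) : IsOrthogonalDecomposition V W := by
  refine ⟨hV, .of_pairwise horth, ?_⟩
  set K := (⨆ i, V i).topologicalClosure
  have : CompleteSpace K := (Submodule.isClosed_topologicalClosure _).completeSpace_coe
  have hKW : K ≤ W := Submodule.topologicalClosure_minimal _ (iSup_le hVW) hW
  have hperp : Kᗮ ⊓ W = ⊥ := by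
    refine (Submodule.eq_bot_iff _).2 fun f hf => htotal f hf.2 fun i => ?_
    exact Submodule.orthogonal_le ((le_iSup V i).trans (Submodule.le_topologicalClosure _)) hf.1
  simpa [hperp] using (Submodule.sup_orthogonal_inf_of_hasOrthogonalProjection hKW).symm

lemma IsOrthogonalDecomposition.hasSum_of_projections [CompleteSpace E] {ι : Type*}
    {V : ι → Submodule ℂ E} (hV : IsOrthogonalDecomposition V ⊤) {P : ι → E →L[ℂ] E}
    (hP : ∀ i, ∀ f ∈ V i, P i f = f) (hP₀ : ∀ i j, i ≠ j → ∀ f ∈ V j, P i f = 0) (f : E) :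
    HasSum (fun i => P i f) f := by
  obtain ⟨hclosed, horth, htop⟩ := hV
  have (i : ι) : CompleteSpace (V i) := (hclosed i).completeSpace_coe
  have hsum : IsHilbertSum ℂ (fun i => V i) (fun i => (V i).subtypeₗᵢ) :=
    IsHilbertSum.mkInternal _ horth htop.le
  set w := hsum.linearIsometryEquiv f
  have hw : HasSum (fun i => (w i : E)) f := by
    simpa [w] using hsum.hasSum_linearIsometryEquiv_symm w
  convert hw using 2 with i
  refine ((P i).hasSum hw).unique ?_
  simpa only [hP i _ (w i).2] using
    hasSum_single (f := fun j => P i (w j)) i fun j hj => hP₀ i j hj.symm _ (w j).2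

lemma inner_eq_zero_of_eigenvector (T : E →ₗᵢ[ℂ] E) {z w : ℂ} (hzw : z ≠ w) {x y : E}
    (hx : T x = z • x) (hy : T y = w • y) : inner ℂ x y = 0 := by
  rcases eq_or_ne x 0 with rfl | hx₀
  · exact inner_zero_left y
  have hz : ‖z‖ = 1 := by
    have h : ‖z‖ * ‖x‖ = 1 * ‖x‖ := by rw [← norm_smul, ← hx, T.norm_map, one_mul]
    exact mul_right_cancel₀ (norm_ne_zero_iff.2 hx₀) h
  have hzz : z * starRingEnd ℂ z = 1 := by simp [Complex.mul_conj, Complex.normSq_eq_norm_sq, hz]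
  have h : starRingEnd ℂ z * (w * inner ℂ x y) = inner ℂ x y := by
    rw [← inner_smul_right, ← inner_smul_left, ← hx, ← hy, T.inner_map_map]
  have h' : (w - z) * inner ℂ x y = 0 := by
    linear_combination z * h - w * inner ℂ x y * hzz
  exact (mul_eq_zero.1 h').resolve_left (sub_ne_zero.2 hzw.symm)

end Hilbert

section Measure

variable {X Y : Type*} [MeasurableSpace X] [MeasurableSpace Y]

lemma integral_comp_of_measurePreserving {E : Type*} [NormedAddCommGroup E] [NormedSpace ℝ E]
    {μ : Measure X} {ν : Measure Y} {g : X → Y} (hg : MeasurePreserving g μ ν) {f : Y → E}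
    (hf : AEStronglyMeasurable f ν) : ∫ x, f (g x) ∂μ = ∫ y, f y ∂ν := by
  rw [← hg.map_eq] at hf ⊢
  exact (integral_map hg.measurable.aemeasurable hf).symm

lemma eLpNorm_two_sq {E : Type*} [NormedAddCommGroup E] (f : X → E) (μ : Measure X) :
    eLpNorm f 2 μ ^ 2 = ∫⁻ x, ‖f x‖ₑ ^ 2 ∂μ := by
  simpa using eLpNorm_nnreal_pow_eq_lintegral (f := f) (μ := μ) (p := 2) (by norm_num)

lemma enorm_integral_sq_le_lintegral {E : Type*} [NormedAddCommGroup E] [NormedSpace ℝ E]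
    {μ : Measure X} [IsProbabilityMeasure μ] {f : X → E} (hf : AEStronglyMeasurable f μ) :
    ‖∫ x, f x ∂μ‖ₑ ^ 2 ≤ ∫⁻ x, ‖f x‖ₑ ^ 2 ∂μ := by
  rw [← eLpNorm_two_sq]
  refine pow_le_pow_left' ((enorm_integral_le_lintegral_enorm f).trans ?_) 2
  rw [← eLpNorm_one_eq_lintegral_enorm]
  exact eLpNorm_le_eLpNorm_of_exponent_le one_le_two hf

end Measure

section FourierChar

lemma coe_fourierChar (x : ℝ) : (𝐞 x : ℂ) = Complex.exp (2 * Real.pi * Complex.I * x) := by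
  rw [Real.fourierChar_apply]
  congr 1
  push_cast
  ring

lemma fourierChar_mul_fourierChar (x y : ℝ) : (𝐞 x : ℂ) * 𝐞 y = 𝐞 (x + y) := by
  rw [AddChar.map_add_eq_mul, Circle.coe_mul]

lemma conj_fourierChar (x : ℝ) : starRingEnd ℂ (𝐞 x) = 𝐞 (-x) := by
  rw [AddChar.map_neg_eq_inv, Circle.coe_inv_eq_conj]

lemma fourierChar_eq_one_iff {x : ℝ} : 𝐞 x = 1 ↔ ∃ n : ℤ, x = n := by
  rw [Real.fourierChar_apply', Circle.exp_eq_one]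
  refine exists_congr fun n => ?_
  rw [mul_comm, mul_left_inj' Real.two_pi_pos.ne']

lemma fourierChar_congr {x y : ℝ} (n : ℤ) (h : x = y + n) : 𝐞 x = 𝐞 y := by
  rw [h, AddChar.map_add_eq_mul, fourierChar_eq_one_iff.2 ⟨n, rfl⟩, mul_one]

lemma fourier_coe_eq_fourierChar (n : ℤ) (x : ℝ) :
    fourier n (x : UnitAddCircle) = 𝐞 (n * x) := by
  rw [fourier_coe_apply, coe_fourierChar]
  simp [mul_assoc]

@[fun_prop]
lemma continuous_coe_fourierChar : Continuous fun x : ℝ => (𝐞 x : ℂ) :=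
  continuous_subtype_val.comp Real.continuous_fourierChar

lemma integrable_mul_fourierChar {X : Type*} [MeasurableSpace X] {μ : Measure X} {g : X → ℂ}
    (hg : Integrable g μ) {φ : X → ℝ} (hφ : Measurable φ) :
    Integrable (fun x => g x * 𝐞 (φ x)) μ :=
  hg.mul_bdd (c := 1) (continuous_coe_fourierChar.measurable.comp hφ).aestronglyMeasurable
    (.of_forall fun _ => (Circle.norm_coe _).le)

end FourierChar

/-! ### The nilmanifold as the unit cube and its Fourier modes -/

lemma apply_out_mk {X : Type*} {φ : Heis → X} (hφ : ∀ γ ∈ Gamma, ∀ x, φ (γ * x) = φ x)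
    (x : Heis) : φ (Quotient.out (mk x)) = φ x := by
  have h : mk x = mk (Quotient.out (mk x)) := (Quotient.out_eq (mk x)).symm
  simpa using hφ _ (mk_eq_mk.1 h) x

lemma onM_mk {φ : Heis → ℂ} (hφ : IsPeriodic φ) (x : Heis) : onM φ (mk x) = φ x :=
  apply_out_mk hφ x

lemma mk_mul_left {γ : Heis} (hγ : γ ∈ Gamma) (x : Heis) : mk (γ * x) = mk x :=
  mk_eq_mk.2 (by simpa [mul_inv_rev] using Gamma.inv_mem hγ)

/-- The representative of `Γ x` in the cube `[0,1)³`. -/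
def reduce (x : Heis) : Heis :=
  ⟨Int.fract x.a, Int.fract x.b, Int.fract (x.c - ⌊x.a⌋ * x.b)⟩

lemma reduce_mul_left {γ : Heis} (hγ : γ ∈ Gamma) (x : Heis) : reduce (γ * x) = reduce x := by
  obtain ⟨m, n, p, rfl⟩ := hγ
  ext
  · simp [reduce]
  · simp [reduce]
  · simp only [reduce, Heis.mul_a, Heis.mul_b, Heis.mul_c, Int.floor_intCast_add]
    rw [Int.fract_eq_fract]
    exact ⟨p - (m + ⌊x.a⌋) * n, by push_cast; ring⟩

lemma mk_reduce (x : Heis) : mk (reduce x) = mk x := by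
  have h : reduce x = ⟨(-⌊x.a⌋ : ℤ), (-⌊x.b⌋ : ℤ), (-⌊x.c - ⌊x.a⌋ * x.b⌋ : ℤ)⟩ * x := by
    ext <;> simp only [reduce, Int.fract, Heis.mul_a, Heis.mul_b, Heis.mul_c] <;> push_cast <;> ring
  rw [h, mk_mul_left ⟨_, _, _, rfl⟩]

lemma reduce_mem_cube (x : Heis) : reduce x ∈ cube :=
  ⟨⟨Int.fract_nonneg _, Int.fract_lt_one _⟩, ⟨Int.fract_nonneg _, Int.fract_lt_one _⟩,
    ⟨Int.fract_nonneg _, Int.fract_lt_one _⟩⟩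

lemma reduce_of_mem_cube {x : Heis} (hx : x ∈ cube) : reduce x = x := by
  obtain ⟨ha, hb, hc⟩ := hx
  have hfloor : ⌊x.a⌋ = 0 := Int.floor_eq_zero_iff.2 ha
  ext
  · simpa [reduce] using Int.fract_eq_self.2 ha
  · simpa [reduce] using Int.fract_eq_self.2 hb
  · simpa [reduce, hfloor] using Int.fract_eq_self.2 hc

lemma measurable_reduce : Measurable reduce := by
  have hfloor : Measurable fun x : Heis => ((⌊x.a⌋ : ℤ) : ℝ) :=
    measurable_from_top.comp (Int.measurable_floor.comp Heis.measurable_a)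
  exact Heis.measurable_to (measurable_fract.comp Heis.measurable_a)
    (measurable_fract.comp Heis.measurable_b)
    (measurable_fract.comp (Heis.measurable_c.sub (hfloor.mul Heis.measurable_b)))

/-- The representative in the cube `[0,1)³` of a point of `M`. -/
def rep (m : M) : Heis := reduce (Quotient.out m)

lemma rep_mk (x : Heis) : rep (mk x) = reduce x :=
  apply_out_mk (fun _ hγ => reduce_mul_left hγ) x

@[simp] lemma mk_rep (m : M) : mk (rep m) = m := by
  rw [rep, mk_reduce]
  exact Quotient.out_eq m

lemma rep_mem_cube (m : M) : rep m ∈ cube := reduce_mem_cube _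

lemma measurable_rep : Measurable rep := fun s hs => by
  change MeasurableSet (mk ⁻¹' (rep ⁻¹' s))
  have h : mk ⁻¹' (rep ⁻¹' s) = reduce ⁻¹' s := by
    ext x
    simp [rep_mk]
  rw [h]
  exact measurable_reduce hs

/-- Lebesgue measure on `[0,1)`. -/
abbrev unitMeasure : Measure ℝ := volume.restrict (Set.Ico 0 1)

instance : IsProbabilityMeasure unitMeasure := ⟨by simp⟩

/-- Lebesgue measure on `[0,1)³`, as a product so that Fubini's theorem applies. -/
abbrev cubeMeasure : Measure (ℝ × ℝ × ℝ) := unitMeasure.prod (unitMeasure.prod unitMeasure)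

lemma cubeMeasure_eq_restrict : cubeMeasure = volume.restrict (Heis.ofProd ⁻¹' cube) := by
  rw [cubeMeasure, unitMeasure, Measure.prod_restrict, Measure.prod_restrict]
  rfl

/-- The point `Γ(a,b,c)` of `M` attached to a triple `(a,b,c)` of reals. -/
abbrev toM (p : ℝ × ℝ × ℝ) : M := mk (Heis.ofProd p)

lemma measurePreserving_toM : MeasurePreserving toM cubeMeasure muM := by
  refine ⟨measurable_mk.comp Heis.measurable_ofProd, ?_⟩
  rw [cubeMeasure_eq_restrict, muM,
    ← (Heis.mp_ofProd.restrict_preimage measurableSet_cube).map_eq,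
    Measure.map_map measurable_mk Heis.measurable_ofProd]
  rfl

lemma ae_rep_toM : ∀ᵐ p ∂cubeMeasure, rep (toM p) = Heis.ofProd p := by
  rw [cubeMeasure_eq_restrict]
  filter_upwards [ae_restrict_mem (Heis.measurable_ofProd measurableSet_cube)] with p hp
  rw [rep_mk, reduce_of_mem_cube hp]

instance : IsProbabilityMeasure muM := by
  rw [← measurePreserving_toM.map_eq]
  exact Measure.isProbabilityMeasure_map measurePreserving_toM.measurable.aemeasurable

lemma ae_toM {P : M → Prop} (h : ∀ᵐ m ∂muM, P m) : ∀ᵐ p : ℝ × ℝ × ℝ, P (toM p) := by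
  obtain ⟨N, hsub, hNm, hN⟩ := exists_measurable_superset_of_null (ae_iff.1 h)
  have hlift : Heis.haar (mk ⁻¹' N) = 0 := by
    refine isFundamentalDomain_cube.measure_zero_of_invariant _ (fun γ => ?_) ?_
    · ext x
      have hγ : mk (γ⁻¹ • x) = mk x := mk_mul_left (Gamma.inv_mem γ.2) x
      simp [Set.mem_smul_set_iff_inv_smul_mem, hγ]
    · rwa [muM, Measure.map_apply measurable_mk hNm,
        Measure.restrict_apply (measurable_mk hNm)] at hN
  refine ae_iff.2 (measure_mono_null (t := toM ⁻¹' N) (fun p hp => hsub hp) ?_)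
  exact (Heis.mp_ofProd.measure_preimage (measurable_mk hNm).nullMeasurableSet).trans hlift

/-- The function equal to `φ(a) e^{2πi(kb+lc)}` on the cube `[0,1)³`; the modes with
`φ(a) = e^{2πi ja}` are the exponentials of the torus, transplanted to `M`. -/
def cubeMode (φ : ℝ → ℂ) (k l : ℤ) (m : M) : ℂ :=
  φ (rep m).a * 𝐞 (k * (rep m).b + l * (rep m).c)

lemma measurable_cubeMode {φ : ℝ → ℂ} (hφ : Measurable φ) (k l : ℤ) :
    Measurable (cubeMode φ k l) := by
  have hb := Heis.measurable_b.comp measurable_rep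
  have hc := Heis.measurable_c.comp measurable_rep
  exact (hφ.comp (Heis.measurable_a.comp measurable_rep)).mul
    (continuous_coe_fourierChar.measurable.comp ((hb.const_mul _).add (hc.const_mul _)))

lemma norm_cubeMode (φ : ℝ → ℂ) (k l : ℤ) (m : M) : ‖cubeMode φ k l m‖ = ‖φ (rep m).a‖ := by
  rw [cubeMode, norm_mul, Circle.norm_coe, mul_one]

lemma memLp_cubeMode {φ : ℝ → ℂ} (hφ : Measurable φ) (k l : ℤ) {C : ℝ}
    (hC : ∀ t ∈ Set.Ico (0 : ℝ) 1, ‖φ t‖ ≤ C) (p : ℝ≥0∞) : MemLp (cubeMode φ k l) p muM :=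
  MemLp.of_bound (measurable_cubeMode hφ k l).aestronglyMeasurable C
    (.of_forall fun m => by rw [norm_cubeMode]; exact hC _ (rep_mem_cube m).1)

lemma memLp_cubeMode_fourierChar (j k l : ℤ) :
    MemLp (cubeMode (fun a => 𝐞 (j * a)) k l) 2 muM :=
  memLp_cubeMode (by fun_prop) k l (C := 1) (fun _ _ => (Circle.norm_coe _).le) 2

lemma cubeMode_mk (φ : ℝ → ℂ) (k l : ℤ) (a b c : ℝ) :
    cubeMode φ k l (mk ⟨a, b, c⟩) = cubeMode φ k l (mk ⟨a, b, 0⟩) * 𝐞 (l * c) := by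
  simp only [cubeMode, rep_mk, reduce, mul_assoc, fourierChar_mul_fourierChar]
  congr 2
  exact fourierChar_congr (-(l * ⌊c - ⌊a⌋ * b⌋) + l * ⌊0 - ⌊a⌋ * b⌋)
    (by push_cast [Int.fract]; ring)

section CubeMode

variable {φ : ℝ → ℂ} {k l : ℤ} (hφ : MemLp (cubeMode φ k l) 2 muM)

lemma ae_cubeMode_toM :
    ∀ᵐ p ∂cubeMeasure, (hφ.toLp : M → ℂ) (toM p) = φ p.1 * 𝐞 (k * p.2.1 + l * p.2.2) := by
  filter_upwards [measurePreserving_toM.quasiMeasurePreserving.ae hφ.coeFn_toLp, ae_rep_toM]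
    with p hp hrep
  simp only [hp, cubeMode, hrep, Heis.ofProd]

lemma inner_cubeMode_ae_eq (f : L2M) :
    (fun p => inner ℂ ((hφ.toLp : M → ℂ) (toM p)) ((f : M → ℂ) (toM p))) =ᵐ[cubeMeasure]
      fun p => starRingEnd ℂ (φ p.1 * 𝐞 (k * p.2.1 + l * p.2.2)) * (f : M → ℂ) (toM p) :=
  (ae_cubeMode_toM hφ).mono fun p hp => by simp only [hp, RCLike.inner_apply']

include hφ in
lemma integrable_conj_cubeMode_mul (f : L2M) :
    Integrable (fun p => starRingEnd ℂ (φ p.1 * 𝐞 (k * p.2.1 + l * p.2.2)) *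
      (f : M → ℂ) (toM p)) cubeMeasure :=
  (measurePreserving_toM.integrable_comp_of_integrable
    (L2.integrable_inner hφ.toLp f)).congr (inner_cubeMode_ae_eq hφ f)

lemma inner_cubeMode (f : L2M) :
    inner ℂ hφ.toLp f = ∫ p, starRingEnd ℂ (φ p.1 * 𝐞 (k * p.2.1 + l * p.2.2)) *
      (f : M → ℂ) (toM p) ∂cubeMeasure :=
  (integral_comp_of_measurePreserving measurePreserving_toM
    (L2.integrable_inner hφ.toLp f).1).symm.trans
      (integral_congr_ae (inner_cubeMode_ae_eq hφ f))

end CubeMode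

lemma integral_fourierChar_unit (n : ℤ) :
    ∫ t, (𝐞 (n * t) : ℂ) ∂unitMeasure = if n = 0 then 1 else 0 := by
  split_ifs with h
  · simp [h]
  · have hc : (2 * Real.pi * Complex.I * n : ℂ) ≠ 0 :=
      mul_ne_zero Complex.two_pi_I_ne_zero (Int.cast_ne_zero.2 h)
    have hexp : Complex.exp (2 * Real.pi * Complex.I * n) = 1 :=
      Complex.exp_eq_one_iff.2 ⟨n, by ring⟩
    rw [integral_Ico_eq_integral_Ioc, ← intervalIntegral.integral_of_le zero_le_one]
    simp only [coe_fourierChar, Complex.ofReal_mul, Complex.ofReal_intCast, ← mul_assoc]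
    simp [integral_exp_mul_complex hc, hexp]

lemma inner_cubeMode_cubeMode {φ ψ : ℝ → ℂ} {k k' l l' : ℤ}
    (hφ : MemLp (cubeMode φ k l) 2 muM) (hψ : MemLp (cubeMode ψ k' l') 2 muM) :
    inner ℂ hφ.toLp hψ.toLp = (∫ a, starRingEnd ℂ (φ a) * ψ a ∂unitMeasure) *
      ((if k = k' then 1 else 0) * (if l = l' then 1 else 0)) := by
  have hprod : ∀ᵐ p ∂cubeMeasure, starRingEnd ℂ (φ p.1 * 𝐞 (k * p.2.1 + l * p.2.2)) *
      (hψ.toLp : M → ℂ) (toM p) = (starRingEnd ℂ (φ p.1) * ψ p.1) *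
        ((𝐞 ((k' - k : ℤ) * p.2.1) : ℂ) * 𝐞 ((l' - l : ℤ) * p.2.2)) := by
    filter_upwards [ae_cubeMode_toM hψ] with p hp
    have hchar : (𝐞 ((k' - k : ℤ) * p.2.1) : ℂ) * 𝐞 ((l' - l : ℤ) * p.2.2) =
        𝐞 (-(k * p.2.1 + l * p.2.2)) * 𝐞 (k' * p.2.1 + l' * p.2.2) := by
      rw [fourierChar_mul_fourierChar, fourierChar_mul_fourierChar]
      congr 2
      push_cast
      ring
    rw [hp, hchar, map_mul, conj_fourierChar]
    ring
  rw [inner_cubeMode, integral_congr_ae hprod,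
    integral_prod_mul (fun a => starRingEnd ℂ (φ a) * ψ a)
      (fun p : ℝ × ℝ => (𝐞 ((k' - k : ℤ) * p.1) : ℂ) * 𝐞 ((l' - l : ℤ) * p.2)),
    integral_prod_mul (fun b => (𝐞 ((k' - k : ℤ) * b) : ℂ)) (fun c => (𝐞 ((l' - l : ℤ) * c) : ℂ)),
    integral_fourierChar_unit, integral_fourierChar_unit]
  simp only [sub_eq_zero, eq_comm (a := k'), eq_comm (a := l')]

/-- The representative in `(0,1]` of a point of the circle. -/
def circleRep (t : UnitAddCircle) : ℝ := AddCircle.measurableEquivIoc 1 0 t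

lemma coe_circleRep (t : UnitAddCircle) : (circleRep t : UnitAddCircle) = t :=
  (AddCircle.measurableEquivIoc 1 0).symm_apply_apply t

lemma measurePreserving_circleRep : MeasurePreserving circleRep volume unitMeasure := by
  have hIoc : unitMeasure = volume.restrict (Set.Ioc (0 : ℝ) (0 + 1)) := by
    rw [unitMeasure, restrict_Ico_eq_restrict_Ioc, zero_add]
  rw [hIoc]
  exact (measurePreserving_subtype_coe measurableSet_Ioc).comp
    (AddCircle.measurePreserving_equivIoc 1 (a := 0))

/-- The normalized Haar measure of the torus, in the form used by `UnitAddTorus.mFourierBasis`. -/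
abbrev torusMeasure (d : Type*) [Fintype d] : Measure (UnitAddTorus d) :=
  Measure.pi fun _ => AddCircle.haarAddCircle

lemma torusMeasure_eq_volume (d : Type*) [Fintype d] : torusMeasure d = volume := by
  have h : (AddCircle.haarAddCircle : Measure UnitAddCircle) = volume := by
    simp [AddCircle.volume_eq_smul_haarAddCircle]
  rw [torusMeasure, h]
  rfl

lemma eq_zero_of_mFourierCoeff_eq_zero {d : Type*} [Fintype d] (g : Lp ℂ 2 (torusMeasure d))
    (h : ∀ n, UnitAddTorus.mFourierCoeff g n = 0) : g = 0 := by
  have hrepr : UnitAddTorus.mFourierBasis.repr g = 0 := by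
    ext n
    rw [UnitAddTorus.mFourierBasis_repr]
    exact h n
  simpa using hrepr

/-- The representative in `(0,1]³` of a point of the torus. -/
def torusRep (t : UnitAddTorus (Fin 3)) : ℝ × ℝ × ℝ :=
  (circleRep (t 0), circleRep (t 1), circleRep (t 2))

lemma measurePreserving_torusRep : MeasurePreserving torusRep (torusMeasure _) cubeMeasure := by
  rw [torusMeasure_eq_volume]
  have hsplit := volume_preserving_piFinSuccAbove (fun _ : Fin 3 => UnitAddCircle) 0
  have hsplit' := volume_preserving_piFinTwo (fun _ : Fin 2 => UnitAddCircle)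
  exact (measurePreserving_circleRep.prod
    ((measurePreserving_circleRep.prod measurePreserving_circleRep).comp hsplit')).comp hsplit

lemma mFourier_eq_fourierChar_torusRep (n : Fin 3 → ℤ) (t : UnitAddTorus (Fin 3)) :
    UnitAddTorus.mFourier n t = 𝐞 (n 0 * (torusRep t).1) *
      𝐞 (n 1 * (torusRep t).2.1 + n 2 * (torusRep t).2.2) := by
  have hcoord (j : ℤ) (s : UnitAddCircle) : fourier j s = 𝐞 (j * circleRep s) := by
    rw [← fourier_coe_eq_fourierChar, coe_circleRep]
  simp only [UnitAddTorus.mFourier, ContinuousMap.coe_mk, Fin.prod_univ_three, hcoord, torusRep,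
    fourierChar_mul_fourierChar, add_assoc]

lemma eq_zero_of_inner_cubeMode_fourierChar (f : L2M)
    (h : ∀ j k l : ℤ, inner ℂ (memLp_cubeMode_fourierChar j k l).toLp f = 0) : f = 0 := by
  have hM := measurePreserving_toM.comp measurePreserving_torusRep
  let pullback : L2M →ₗᵢ[ℂ] Lp ℂ 2 (torusMeasure (Fin 3)) := Lp.compMeasurePreservingₗᵢ ℂ _ hM
  set g := pullback f
  have hgf : g =ᵐ[torusMeasure _] fun t => (f : M → ℂ) (toM (torusRep t)) :=
    Lp.coeFn_compMeasurePreserving f hM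
  suffices g = 0 from (map_eq_zero_iff pullback pullback.injective).1 this
  refine eq_zero_of_mFourierCoeff_eq_zero g fun n => ?_
  set G : ℝ × ℝ × ℝ → ℂ := fun p =>
    starRingEnd ℂ (𝐞 (n 0 * p.1) * 𝐞 (n 1 * p.2.1 + n 2 * p.2.2)) * (f : M → ℂ) (toM p)
  have hG : AEStronglyMeasurable G cubeMeasure :=
    (Continuous.aestronglyMeasurable (Complex.continuous_conj.comp (by fun_prop))).mul
      ((Lp.aestronglyMeasurable f).comp_measurePreserving measurePreserving_toM)
  calc UnitAddTorus.mFourierCoeff g n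
    _ = ∫ t, G (torusRep t) ∂torusMeasure _ :=
      integral_congr_ae (hgf.mono fun t ht => by
        simp only [smul_eq_mul, ht, UnitAddTorus.mFourier_neg, mFourier_eq_fourierChar_torusRep, G])
    _ = ∫ p, G p ∂cubeMeasure := integral_comp_of_measurePreserving measurePreserving_torusRep hG
    _ = 0 := by rw [← h (n 0) (n 1) (n 2), inner_cubeMode]

/-! ### Central Fourier modes and the right regular representation -/

/-- The action `(ẋ, t) ↦ ẋ (0,0,t)` of the centre of the Heisenberg group on `M`. -/
def centralAct (q : M × ℝ) : M := rmul ⟨0, 0, q.2⟩ q.1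

lemma centralAct_mk (a b c t : ℝ) : centralAct (mk ⟨a, b, c⟩, t) = mk ⟨a, b, c + t⟩ := by
  change mk _ = _
  congr 1
  ext <;> simp

lemma measurable_centralAct : Measurable centralAct := by
  have h : centralAct = fun q => mk (rep q.1 * ⟨0, 0, q.2⟩) := by
    funext q
    rw [← rmul_mk, mk_rep, centralAct]
  have hrep : Measurable fun q : M × ℝ => rep q.1 := measurable_rep.comp measurable_fst
  rw [h]
  refine measurable_mk.comp (Heis.measurable_to ?_ ?_ ?_)
  · simp only [Heis.mul_a, add_zero]
    exact Heis.measurable_a.comp hrep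
  · simp only [Heis.mul_b, add_zero]
    exact Heis.measurable_b.comp hrep
  · simp only [Heis.mul_c, mul_zero, add_zero]
    exact (Heis.measurable_c.comp hrep).add measurable_snd

lemma measurePreserving_centralAct :
    MeasurePreserving centralAct (muM.prod unitMeasure) muM := by
  have hskew : MeasurePreserving (fun q : ℝ × M => (q.1, centralAct (q.2, q.1)))
      (unitMeasure.prod muM) (unitMeasure.prod muM) :=
    MeasurePreserving.skew_product (g := fun t m => centralAct (m, t)) (.id _)
      (measurable_centralAct.comp measurable_swap)
      (.of_forall fun t => (mp_rmul ⟨0, 0, t⟩).map_eq)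
  exact (measurePreserving_snd.comp hskew).comp Measure.measurePreserving_swap

/-- The function `ẋ ↦ ∫₀¹ f(ẋ (0,0,t)) e^{-2πilt} dt`: the `l`-th Fourier component of `f` along
the orbits of the centre. -/
def centralCoeff (l : ℤ) (f : M → ℂ) (m : M) : ℂ :=
  ∫ t, f (centralAct (m, t)) * 𝐞 (-(l * t)) ∂unitMeasure

lemma periodic_central (f : M → ℂ) (a b : ℝ) :
    Function.Periodic (fun t : ℝ => f (mk ⟨a, b, t⟩)) 1 := fun t => by
  have h : (⟨a, b, t + 1⟩ : Heis) = ⟨(0 : ℤ), (0 : ℤ), (1 : ℤ)⟩ * ⟨a, b, t⟩ := by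
    ext <;> simp [add_comm]
  simp only [h, mk_mul_left (γ := ⟨(0 : ℤ), (0 : ℤ), (1 : ℤ)⟩) ⟨_, _, _, rfl⟩]

lemma centralCoeff_mk (l : ℤ) (f : M → ℂ) (a b c : ℝ) :
    centralCoeff l f (mk ⟨a, b, c⟩) =
      𝐞 (l * c) * ∫ t in (0 : ℝ)..1, f (mk ⟨a, b, t⟩) * 𝐞 (-(l * t)) := by
  set F : ℝ → ℂ := fun t => f (mk ⟨a, b, t⟩) * 𝐞 (-(l * t))
  have hF : Function.Periodic F 1 := (periodic_central f a b).mul fun t =>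
    congrArg Subtype.val (fourierChar_congr (-l) (by push_cast; ring))
  have hshift (t : ℝ) :
      f (centralAct (mk ⟨a, b, c⟩, t)) * 𝐞 (-(l * t)) = 𝐞 (l * c) * F (c + t) := by
    rw [centralAct_mk, mul_left_comm, fourierChar_mul_fourierChar]
    congr 3
    ring
  rw [centralCoeff, integral_Ico_eq_integral_Ioc, ← intervalIntegral.integral_of_le zero_le_one]
  simp only [hshift, intervalIntegral.integral_const_mul]
  rw [intervalIntegral.integral_comp_add_left F]
  simpa using hF.intervalIntegral_add_eq c 0

lemma memLp_centralAct (f : L2M) :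
    MemLp (fun q => (f : M → ℂ) (centralAct q)) 2 (muM.prod unitMeasure) :=
  (Lp.memLp f).comp_measurePreserving measurePreserving_centralAct

lemma ae_integrable_centralAct (f : L2M) :
    ∀ᵐ m ∂muM, Integrable (fun t => (f : M → ℂ) (centralAct (m, t))) unitMeasure :=
  ((memLp_centralAct f).integrable one_le_two).prod_right_ae

lemma ae_integrable_centralAct_mul_fourierChar (l : ℤ) (f : L2M) : ∀ᵐ m ∂muM,
    Integrable (fun t => (f : M → ℂ) (centralAct (m, t)) * 𝐞 (-(l * t))) unitMeasure :=
  (ae_integrable_centralAct f).mono fun _ hm => integrable_mul_fourierChar hm (by fun_prop)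

lemma aestronglyMeasurable_centralCoeff (l : ℤ) (f : L2M) :
    AEStronglyMeasurable (centralCoeff l f) muM :=
  AEStronglyMeasurable.integral_prod_right' (f := fun q : M × ℝ =>
    (f : M → ℂ) (centralAct q) * 𝐞 (-(l * q.2))) ((memLp_centralAct f).1.mul
      (continuous_coe_fourierChar.measurable.comp (by fun_prop)).aestronglyMeasurable)

lemma eLpNorm_centralCoeff_le (l : ℤ) (f : L2M) :
    eLpNorm (centralCoeff l f) 2 muM ≤ eLpNorm f 2 muM := by
  rw [← eLpNorm_comp_measurePreserving (Lp.aestronglyMeasurable f) measurePreserving_centralAct,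
    ← ENNReal.pow_le_pow_left_iff two_ne_zero, eLpNorm_two_sq, eLpNorm_two_sq]
  simp only [Function.comp_apply]
  rw [lintegral_prod _ ((memLp_centralAct f).1.enorm.pow_const 2)]
  refine lintegral_mono_ae ?_
  filter_upwards [ae_integrable_centralAct_mul_fourierChar l f] with m hm
  refine (enorm_integral_sq_le_lintegral hm.1).trans_eq (lintegral_congr fun t => ?_)
  rw [← ofReal_norm, norm_mul, Circle.norm_coe, mul_one, ofReal_norm]

lemma memLp_centralCoeff (l : ℤ) (f : L2M) : MemLp (centralCoeff l f) 2 muM :=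
  ⟨aestronglyMeasurable_centralCoeff l f,
    (eLpNorm_centralCoeff_le l f).trans_lt (Lp.eLpNorm_lt_top f)⟩

lemma centralCoeff_congr {f F : M → ℂ} (h : f =ᵐ[muM] F) (l : ℤ) :
    centralCoeff l f =ᵐ[muM] centralCoeff l F :=
  (Measure.ae_ae_of_ae_prod
    (measurePreserving_centralAct.quasiMeasurePreserving.ae_eq_comp h)).mono fun _ hm =>
      integral_congr_ae (hm.mono fun t ht => congrArg (· * (𝐞 (-(l * t)) : ℂ)) ht)

/-- The orthogonal projection of `L²(M)` onto `L²_l(M)`, given by the `l`-th Fourier component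
along the centre. -/
def centralProj (l : ℤ) : L2M →L[ℂ] L2M :=
  LinearMap.mkContinuous
    { toFun := fun f => (memLp_centralCoeff l f).toLp
      map_add' := fun f g => by
        rw [← MemLp.toLp_add, MemLp.toLp_eq_toLp_iff]
        refine (centralCoeff_congr (Lp.coeFn_add f g) l).trans ?_
        filter_upwards [ae_integrable_centralAct_mul_fourierChar l f,
          ae_integrable_centralAct_mul_fourierChar l g] with m hf hg
        simpa only [centralCoeff, Pi.add_apply, add_mul] using integral_add hf hg
      map_smul' := fun z f => by
        rw [RingHom.id_apply, ← MemLp.toLp_const_smul, MemLp.toLp_eq_toLp_iff]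
        refine (centralCoeff_congr (Lp.coeFn_smul z f) l).trans (.of_forall fun m => ?_)
        simpa only [centralCoeff, Pi.smul_apply, smul_eq_mul, mul_assoc] using
          integral_const_mul _ _ } 1 fun f => by
    change ‖(memLp_centralCoeff l f).toLp‖ ≤ 1 * ‖f‖
    rw [one_mul, Lp.norm_toLp, Lp.norm_def]
    exact ENNReal.toReal_mono (Lp.eLpNorm_ne_top f) (eLpNorm_centralCoeff_le l f)

lemma coeFn_centralProj (l : ℤ) (f : L2M) :
    (centralProj l f : M → ℂ) =ᵐ[muM] centralCoeff l f :=
  (memLp_centralCoeff l f).coeFn_toLp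

lemma mem_centralMode_iff {l : ℤ} {f : L2M} : f ∈ centralMode l ↔
    ∃ F : M → ℂ, (f : M → ℂ) =ᵐ[muM] F ∧
      ∀ a b c : ℝ, F (mk ⟨a, b, c⟩) = F (mk ⟨a, b, 0⟩) * 𝐞 (l * c) := by
  simp only [coe_fourierChar, Complex.ofReal_mul, Complex.ofReal_intCast, ← mul_assoc]
  rfl

lemma exists_equivariant_of_mem_centralMode {l : ℤ} {f : L2M} (hf : f ∈ centralMode l) :
    ∃ F : M → ℂ, (f : M → ℂ) =ᵐ[muM] F ∧
      ∀ m t, F (centralAct (m, t)) = 𝐞 (l * t) * F m := by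
  obtain ⟨F, hfF, hF⟩ := mem_centralMode_iff.1 hf
  refine ⟨F, hfF, fun m t => ?_⟩
  obtain ⟨⟨a, b, c⟩, rfl⟩ := mk_surjective m
  rw [centralAct_mk, hF a b (c + t), hF a b c, mul_add, ← fourierChar_mul_fourierChar]
  ring

lemma centralProj_mem (l : ℤ) (f : L2M) : centralProj l f ∈ centralMode l :=
  mem_centralMode_iff.2 ⟨_, coeFn_centralProj l f, fun a b c => by
    rw [centralCoeff_mk, centralCoeff_mk l f a b 0, mul_zero, AddChar.map_zero_eq_one]
    simp [mul_comm]⟩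

lemma centralProj_of_mem {l l' : ℤ} {f : L2M} (hf : f ∈ centralMode l') :
    centralProj l f = (if l' = l then (1 : ℂ) else 0) • f := by
  obtain ⟨F, hfF, hF⟩ := exists_equivariant_of_mem_centralMode hf
  have hcoeff (m : M) : centralCoeff l F m = (if l' = l then (1 : ℂ) else 0) * F m := by
    have h (t : ℝ) : F (centralAct (m, t)) * 𝐞 (-(l * t)) = 𝐞 ((l' - l : ℤ) * t) * F m := by
      rw [hF, mul_right_comm, fourierChar_mul_fourierChar]
      congr 3
      push_cast
      ring
    simp only [centralCoeff, h, integral_mul_const, integral_fourierChar_unit, sub_eq_zero]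
  refine Lp.ext ((coeFn_centralProj l f).trans ((centralCoeff_congr hfF l).trans ?_))
  filter_upwards [hfF, Lp.coeFn_smul (if l' = l then (1 : ℂ) else 0) f] with m hm hsmul
  rw [hcoeff, hsmul, Pi.smul_apply, smul_eq_mul, hm]

lemma isClosed_centralMode (l : ℤ) : IsClosed (centralMode l : Set L2M) := by
  have h : (centralMode l : Set L2M) = {f | centralProj l f = f} := by
    refine Set.Subset.antisymm (fun f hf => by simp [centralProj_of_mem hf]) fun f hf => ?_
    exact Set.mem_of_eq_of_mem (Eq.symm hf) (centralProj_mem l f)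
  rw [h]
  exact isClosed_eq (centralProj l).continuous continuous_id

lemma regRep_center {l : ℤ} {f : L2M} (hf : f ∈ centralMode l) (t : ℝ) :
    regRep ⟨0, 0, t⟩ f = (𝐞 (l * t) : ℂ) • f := by
  obtain ⟨F, hfF, hF⟩ := exists_equivariant_of_mem_centralMode hf
  refine Lp.ext ((coeFn_regRep _ f).trans ?_)
  filter_upwards [(mp_rmul ⟨0, 0, t⟩).quasiMeasurePreserving.ae_eq_comp hfF, hfF,
    Lp.coeFn_smul (𝐞 (l * t) : ℂ) f] with m hrmul hm hsmul
  rw [hsmul, Pi.smul_apply, hm]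
  exact Eq.trans hrmul (hF m t)

lemma centralMode_isOrtho : Pairwise fun l l' => centralMode l ⟂ centralMode l' := by
  intro l l' hl
  have hl' : (l : ℝ) - l' ≠ 0 := sub_ne_zero.2 (Int.cast_injective.ne hl)
  -- `(0,0,t)` acts on the two modes by scalars which differ by a factor `-1`
  set t : ℝ := 1 / (2 * (l - l')) with ht
  have hchar : (𝐞 (l * t) : ℂ) ≠ 𝐞 (l' * t) := fun heq => by
    have h : 𝐞 (l * t - l' * t) = 1 := by
      rw [AddChar.map_sub_eq_div, Subtype.ext heq, div_self']
    obtain ⟨n, hn⟩ := fourierChar_eq_one_iff.1 h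
    have : (1 : ℝ) = 2 * n := by rw [← hn, ht]; field_simp
    have : (1 : ℤ) = 2 * n := by exact_mod_cast this
    omega
  exact Submodule.isOrtho_iff_inner_eq.2 fun f hf g hg => inner_eq_zero_of_eigenvector
    (regRep ⟨0, 0, t⟩).toLinearIsometry hchar (regRep_center hf t) (regRep_center hg t)

lemma cubeMode_mem_centralMode {φ : ℝ → ℂ} {k l : ℤ} (hφ : MemLp (cubeMode φ k l) 2 muM) :
    hφ.toLp ∈ centralMode l :=
  mem_centralMode_iff.2 ⟨_, hφ.coeFn_toLp, cubeMode_mk φ k l⟩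

lemma eq_zero_of_mem_centralMode {l : ℤ} {f : L2M} (hf : f ∈ centralMode l)
    (h : ∀ j k : ℤ, inner ℂ (memLp_cubeMode_fourierChar j k l).toLp f = 0) : f = 0 := by
  refine eq_zero_of_inner_cubeMode_fourierChar f fun j k l' => ?_
  rcases eq_or_ne l' l with rfl | hl
  · exact h j k
  · exact (centralMode_isOrtho hl).inner_eq (cubeMode_mem_centralMode _) hf

theorem isOrthogonalDecomposition_centralMode : IsOrthogonalDecomposition centralMode ⊤ := by
  refine .of_total isClosed_centralMode isClosed_univ (fun _ => le_top) centralMode_isOrtho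
    fun f _ hf => eq_zero_of_inner_cubeMode_fourierChar f fun j k l => ?_
  exact (Submodule.mem_orthogonal _ _).1 (hf l) _ (cubeMode_mem_centralMode _)

theorem isInvariant_centralMode (l : ℤ) : IsInvariant regRep (centralMode l) := by
  intro g f hf
  obtain ⟨F, hfF, hF⟩ := mem_centralMode_iff.1 hf
  refine mem_centralMode_iff.2 ⟨fun m => F (rmul g m), (coeFn_regRep g f).trans
    ((mp_rmul g).quasiMeasurePreserving.ae_eq_comp hfF), fun a b c => ?_⟩
  have h (c : ℝ) : (⟨a, b, c⟩ * g : Heis) = ⟨a + g.a, b + g.b, c + (g.c + a * g.b)⟩ := by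
    ext <;> simp
    ring
  simp only [rmul_mk, h]
  rw [hF _ _ (c + _), hF _ _ (0 + _), mul_assoc, fourierChar_mul_fourierChar]
  congr 3
  ring

theorem hasSum_centralProj (f : L2M) : HasSum (fun l => centralProj l f) f :=
  isOrthogonalDecomposition_centralMode.hasSum_of_projections
    (fun _ _ hf => by simp [centralProj_of_mem hf])
    (fun _ _ hl _ hf => by simp [centralProj_of_mem hf, hl.symm]) f

theorem ae_centralProj_eq (l : ℤ) (f : L2M) : ∀ᵐ p : ℝ × ℝ × ℝ,
    IntervalIntegrable (fun t : ℝ => (f : M → ℂ) (mk ⟨p.1, p.2.1, t⟩)) volume 0 1 ∧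
    (centralProj l f : M → ℂ) (mk ⟨p.1, p.2.1, p.2.2⟩) =
      Complex.exp (2 * Real.pi * Complex.I * l * p.2.2) *
        ∫ t in (0 : ℝ)..1, (f : M → ℂ) (mk ⟨p.1, p.2.1, t⟩) *
          Complex.exp (-(2 * Real.pi * Complex.I * l * t)) := by
  filter_upwards [ae_toM (ae_integrable_centralAct f), ae_toM (coeFn_centralProj l f)]
    with ⟨a, b, c⟩ hint hproj
  constructor
  · simp only [toM, Heis.ofProd, centralAct_mk] at hint
    have hshift := ((intervalIntegrable_iff_integrableOn_Ico_of_le zero_le_one).2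
      hint).comp_add_left (-c)
    simp only [add_neg_cancel_left, sub_neg_eq_add, zero_add] at hshift
    refine (periodic_central (f : M → ℂ) a b).intervalIntegrable one_ne_zero (t := c) ?_ 0 1
    rwa [add_comm c 1]
  · refine hproj.trans ((centralCoeff_mk l f a b c).trans ?_)
    simp [coe_fourierChar, mul_assoc]

lemma chiLift_eq (w : ℤ × ℤ) (x : Heis) : chiLift w x = 𝐞 (w.1 * x.a + w.2 * x.b) := by
  simp [chiLift, coe_fourierChar]

theorem isPeriodic_chiLift (w : ℤ × ℤ) : IsPeriodic (chiLift w) := by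
  rintro _ ⟨m, n, p, rfl⟩ x
  rw [chiLift_eq, chiLift_eq]
  exact congrArg Subtype.val (fourierChar_congr (w.1 * m + w.2 * n) (by
    simp only [Heis.mul_a, Heis.mul_b]
    push_cast
    ring))

theorem chi_mk (w : ℤ × ℤ) (x : Heis) : chi w (mk x) = chiLift w x :=
  onM_mk (isPeriodic_chiLift w) x

lemma contDiff_coe_fourierChar : ContDiff ℝ ∞ fun x : ℝ => (𝐞 x : ℂ) := by
  simp only [coe_fourierChar]
  exact (contDiff_const.mul Complex.ofRealCLM.contDiff).cexp

theorem smoothOnM_chi (w : ℤ × ℤ) : SmoothOnM (chi w) := by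
  simp only [SmoothOnM, chi_mk, chiLift_eq, Heis.ofProd]
  exact contDiff_coe_fourierChar.comp (by fun_prop)

lemma chi_rmul (w : ℤ × ℤ) (g : Heis) (m : M) : chi w (rmul g m) = chiLift w g * chi w m := by
  obtain ⟨x, rfl⟩ := mk_surjective m
  simp only [rmul_mk, chi_mk, chiLift_eq, Heis.mul_a, Heis.mul_b, fourierChar_mul_fourierChar]
  congr 2
  ring

lemma chi_eq_cubeMode (w : ℤ × ℤ) : chi w = cubeMode (fun a => 𝐞 (w.1 * a)) w.2 0 := by
  funext m
  rw [← mk_rep m, chi_mk, chiLift_eq, mk_rep]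
  simp [cubeMode, fourierChar_mul_fourierChar]

/-- The character `χ_w` as an element of `L²(M)`. -/
def chiLp (w : ℤ × ℤ) : L2M := (memLp_cubeMode_fourierChar w.1 w.2 0).toLp

theorem coeFn_chiLp (w : ℤ × ℤ) : (chiLp w : M → ℂ) =ᵐ[muM] chi w := by
  rw [chi_eq_cubeMode]
  exact MemLp.coeFn_toLp _

lemma regRep_chiLp (g : Heis) (w : ℤ × ℤ) : regRep g (chiLp w) = chiLift w g • chiLp w := by
  refine Lp.ext ((coeFn_regRep g _).trans ?_)
  filter_upwards [(mp_rmul g).quasiMeasurePreserving.ae_eq_comp (coeFn_chiLp w), coeFn_chiLp w,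
    Lp.coeFn_smul (chiLift w g) (chiLp w)] with m hrmul hm hsmul
  rw [hsmul, Pi.smul_apply, hm, smul_eq_mul, ← chi_rmul]
  exact hrmul

lemma inner_chiLp (w w' : ℤ × ℤ) : inner ℂ (chiLp w) (chiLp w') = if w = w' then 1 else 0 := by
  have h (a : ℝ) : starRingEnd ℂ (𝐞 (w.1 * a)) * 𝐞 (w'.1 * a) = 𝐞 ((w'.1 - w.1 : ℤ) * a) := by
    rw [conj_fourierChar, fourierChar_mul_fourierChar]
    congr 2
    push_cast
    ring
  rw [chiLp, chiLp, inner_cubeMode_cubeMode]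
  simp only [h, integral_fourierChar_unit, sub_eq_zero, Prod.ext_iff, eq_comm (a := w'.1)]
  split_ifs <;> simp_all

lemma chiLp_ne_zero (w : ℤ × ℤ) : chiLp w ≠ 0 := fun h => by simpa [h] using inner_chiLp w w

theorem isOrthogonalDecomposition_chiLp :
    IsOrthogonalDecomposition (fun w => Submodule.span ℂ {chiLp w}) (centralMode 0) := by
  refine .of_total (fun w => Submodule.closed_of_finiteDimensional _) (isClosed_centralMode 0)
    (fun w => (Submodule.span_singleton_le_iff_mem _ _).2 (cubeMode_mem_centralMode _))
    (fun w w' h => ?_) fun f hf h => eq_zero_of_mem_centralMode hf fun j k => ?_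
  · exact Submodule.isOrtho_span.2 (by simp [inner_chiLp, h])
  · exact (Submodule.mem_orthogonal_singleton_iff_inner_right).1 (h (j, k))

theorem isIrreducibleOn_chiLp (w : ℤ × ℤ) :
    IsIrreducibleOn regRep (Submodule.span ℂ {chiLp w}) := by
  refine ⟨fun g f hf => ?_, by simpa using chiLp_ne_zero w, fun W hW _ _ =>
    (nonzero_span_atom _ (chiLp_ne_zero w)).le_iff.1 hW⟩
  obtain ⟨z, rfl⟩ := Submodule.mem_span_singleton.1 hf
  rw [map_smul, regRep_chiLp]
  exact Submodule.smul_mem _ _ (Submodule.smul_mem _ _ (Submodule.mem_span_singleton_self _))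

/-! ### Irreducibility of the Schrödinger representation -/

section FourierInjective

variable {V E : Type*} [NormedAddCommGroup V] [InnerProductSpace ℝ V] [FiniteDimensional ℝ V]
  [MeasurableSpace V] [BorelSpace V] [NormedAddCommGroup E] [NormedSpace ℂ E] [CompleteSpace E]

lemma integral_fourier_smul_eq_integral_smul_fourier (φ : 𝓢(V, ℂ)) {F : V → E}
    (hF : Integrable F) :
    ∫ x, (𝓕 φ : 𝓢(V, ℂ)) x • F x = ∫ x, φ x • 𝓕 F x := by
  have h := VectorFourier.integral_fourierIntegral_smul_eq_flip (L := innerₗ V)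
    (μ := volume) (ν := volume) Real.continuous_fourierChar continuous_inner φ.integrable hF
  rw [flip_innerₗ] at h
  rw [SchwartzMap.fourier_coe]
  exact h

theorem ae_eq_zero_of_fourier_eq_zero {F : V → E} (hF : Integrable F) (h : 𝓕 F = 0) :
    F =ᵐ[volume] 0 := by
  refine ae_eq_zero_of_integral_contDiff_smul_eq_zero hF.locallyIntegrable fun g hg hgc => ?_
  -- a test function is the Fourier transform of a Schwartz function
  set G : 𝓢(V, ℂ) := (hgc.comp_left Complex.ofReal_zero).toSchwartzMap
    (Complex.ofRealCLM.contDiff.comp hg)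
  have hG := integral_fourier_smul_eq_integral_smul_fourier (𝓕⁻ G) hF
  rw [FourierTransform.fourier_fourierInv_eq] at hG
  simp only [h, Pi.zero_apply, smul_zero, integral_zero] at hG
  exact hG ▸ integral_congr_ae (.of_forall fun x => (Complex.coe_smul (g x) (F x)).symm)

end FourierInjective

lemma phase_eq (l : ℝ) (g : Heis) (u : ℝ) : phase l g u = 𝐞 (l * (g.c + u * g.b)) := by
  simp [phase, coe_fourierChar, mul_assoc]

lemma inner_schrodinger (l : ℝ) (x : Heis) (f g : L2R) :
    inner ℂ (schrodinger l x f) g =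
      ∫ u, 𝐞 (-(l * (x.c + u * x.b))) * (starRingEnd ℂ ((f : ℝ → ℂ) (u + x.a)) * g u) := by
  rw [L2.inner_def]
  refine integral_congr_ae ((coeFn_schrodinger l x f).mono fun u hu => ?_)
  simp only [RCLike.inner_apply, hu, map_mul, phase_eq, conj_fourierChar]
  ring

lemma integrable_conj_translate_mul (f g : L2R) (a : ℝ) :
    Integrable fun u => starRingEnd ℂ ((f : ℝ → ℂ) (u + a)) * g u :=
  ((Lp.memLp f).comp_measurePreserving (measurePreserving_add_right volume a)).star.integrable_mul
    (Lp.memLp g)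

lemma conj_translate_mul_ae_eq_zero {l : ℝ} (hl : l ≠ 0) {f g : L2R}
    (h : ∀ x, inner ℂ (schrodinger l x f) g = 0) (a : ℝ) :
    (fun u => starRingEnd ℂ ((f : ℝ → ℂ) (u + a)) * g u) =ᵐ[volume] 0 := by
  refine ae_eq_zero_of_fourier_eq_zero (integrable_conj_translate_mul f g a) (funext fun w => ?_)
  rw [Pi.zero_apply, ← h ⟨a, w / l, 0⟩, inner_schrodinger, Real.fourier_eq]
  simp only [Circle.smul_def, smul_eq_mul, RCLike.inner_apply, conj_trivial, zero_add]
  refine integral_congr_ae (.of_forall fun u => ?_)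
  field_simp

lemma lintegral_lintegral_add_mul {G : Type*} [AddGroup G] [MeasurableSpace G] [MeasurableAdd₂ G]
    (μ : Measure G) [SFinite μ] [μ.IsAddLeftInvariant] {F H : G → ℝ≥0∞} (hF : Measurable F)
    (hH : Measurable H) :
    ∫⁻ a, ∫⁻ u, F (u + a) * H u ∂μ ∂μ = (∫⁻ a, F a ∂μ) * ∫⁻ u, H u ∂μ := by
  rw [lintegral_lintegral_swap ((hF.comp (measurable_snd.add measurable_fst)).mul
    (hH.comp measurable_snd)).aemeasurable]
  have h (u : G) : ∫⁻ a, F (u + a) * H u ∂μ = (∫⁻ a, F a ∂μ) * H u := by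
    rw [lintegral_mul_const (f := fun a => F (u + a)) _ (hF.comp (measurable_const_add u)),
      lintegral_add_left_eq_self F u]
  simp only [h, lintegral_const_mul _ hH]

lemma eq_zero_or_eq_zero_of_forall_translate {f g : L2R}
    (h : ∀ a : ℝ, (fun u => starRingEnd ℂ ((f : ℝ → ℂ) (u + a)) * g u) =ᵐ[volume] 0) :
    f = 0 ∨ g = 0 := by
  have hmeas (f : L2R) : Measurable fun u => ‖f u‖ₑ := (Lp.stronglyMeasurable f).measurable.enorm
  have hzero (f : L2R) (hf : ∫⁻ u, ‖f u‖ₑ = 0) : f = 0 :=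
    (Lp.eq_zero_iff_ae_eq_zero).2 (((lintegral_eq_zero_iff (hmeas f)).1 hf).mono fun u hu =>
      enorm_eq_zero.1 hu)
  have hprod : ∫⁻ a : ℝ, ∫⁻ u, ‖f (u + a)‖ₑ * ‖g u‖ₑ = 0 := by
    refine (lintegral_congr fun a => ?_).trans lintegral_zero
    refine (lintegral_congr_ae ((h a).mono fun u hu => ?_)).trans lintegral_zero
    simpa [enorm_mul] using congrArg enorm hu
  rw [lintegral_lintegral_add_mul volume (hmeas f) (hmeas g), mul_eq_zero] at hprod
  exact hprod.imp (hzero f) (hzero g)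

instance : Nontrivial L2R := by
  refine ⟨indicatorConstLp 2 (measurableSet_Icc (a := (0 : ℝ)) (b := 1)) (by simp) 1, 0, ?_⟩
  refine norm_ne_zero_iff.1 ?_
  simp [norm_indicatorConstLp]

theorem isIrreducibleOn_schrodinger {l : ℝ} (hl : l ≠ 0) : IsIrreducibleOn (schrodinger l) ⊤ := by
  refine ⟨fun _ _ _ => trivial, top_ne_bot, fun W _ hW hinv => or_iff_not_imp_left.2 fun hne => ?_⟩
  obtain ⟨f, hfW, hf⟩ := W.ne_bot_iff.1 hne
  have : CompleteSpace W := hW.completeSpace_coe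
  rw [← Submodule.orthogonal_eq_bot_iff, Submodule.eq_bot_iff]
  intro g hg
  exact (eq_zero_or_eq_zero_of_forall_translate (conj_translate_mul_ae_eq_zero hl fun x =>
    (Submodule.mem_orthogonal W g).1 hg _ (hinv x f hfW))).resolve_left hf

/-! ### The Brezin–Weil–Zak series -/

/-- Sequences of at most polynomial growth, as coefficients of Zak series. -/
def PolynomialGrowth (c : ℤ → ℂ) : Prop :=
  ∃ (C : ℝ) (n : ℕ), ∀ k, ‖c k‖ ≤ C * (1 + |(k : ℝ)|) ^ n

lemma PolynomialGrowth.intCast_mul {c : ℤ → ℂ} (hc : PolynomialGrowth c) (z : ℂ) :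
    PolynomialGrowth fun k => z * k * c k := by
  obtain ⟨C, n, h⟩ := hc
  refine ⟨‖z‖ * C, n + 1, fun k => ?_⟩
  calc ‖z * k * c k‖ = ‖z‖ * |(k : ℝ)| * ‖c k‖ := by simp
    _ ≤ ‖z‖ * (1 + |(k : ℝ)|) * (C * (1 + |(k : ℝ)|) ^ n) := by
        gcongr
        · exact le_add_of_nonneg_left zero_le_one
        · exact h k
    _ = ‖z‖ * C * (1 + |(k : ℝ)|) ^ (n + 1) := by ring

lemma polynomialGrowth_fourierChar (φ : ℤ → ℝ) : PolynomialGrowth fun k => 𝐞 (φ k) :=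
  ⟨1, 0, fun k => by simp [Circle.norm_coe]⟩

lemma summable_inv_one_add_abs_sq : Summable fun k : ℤ => ((1 + |(k : ℝ)|) ^ 2)⁻¹ := by
  refine (Real.summable_one_div_int_pow.2 one_lt_two).of_norm_bounded_eventually ?_
  filter_upwards [(Set.finite_singleton (0 : ℤ)).compl_mem_cofinite] with k hk
  have hk : 0 < |(k : ℝ)| := abs_pos.2 (Int.cast_ne_zero.2 hk)
  rw [Real.norm_of_nonneg (by positivity), one_div, ← sq_abs (k : ℝ)]
  gcongr
  linarith

lemma one_add_abs_le_mul_one_add_abs_div_add {l R a : ℝ} (hl : l ≠ 0) (ha : |a| ≤ R) (x : ℝ) :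
    1 + |x| ≤ (1 + |l|) * (1 + R) * (1 + |x / l + a|) := by
  have hR : 0 ≤ R := (abs_nonneg a).trans ha
  have hx : |x| ≤ |l| * (|x / l + a| + R) := by
    calc |x| = |l| * |x / l + a - a| := by rw [← abs_mul]; congr 1; field_simp; ring
      _ ≤ |l| * (|x / l + a| + R) := by gcongr; exact (abs_sub _ a).trans (by gcongr)
  have : 0 ≤ R * |x / l + a| := by positivity
  have : 0 ≤ |l| * (R * |x / l + a|) := by positivity
  nlinarith [abs_nonneg l, abs_nonneg (x / l + a)]

lemma exists_sample_bound {l : ℝ} (hl : l ≠ 0) (h : 𝓢(ℝ, ℂ)) (n : ℕ) (R : ℝ) :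
    ∃ C : ℝ, ∀ x a : ℝ, |a| ≤ R → (1 + |x|) ^ n * ‖h (x / l + a)‖ ≤ C := by
  refine ⟨((1 + |l|) * (1 + R)) ^ n *
    (2 ^ n * ((Finset.Iic (n, 0)).sup fun m => SchwartzMap.seminorm ℂ m.1 m.2) h),
    fun x a ha => ?_⟩
  have hR : 0 ≤ R := (abs_nonneg a).trans ha
  calc (1 + |x|) ^ n * ‖h (x / l + a)‖
      ≤ ((1 + |l|) * (1 + R) * (1 + |x / l + a|)) ^ n * ‖h (x / l + a)‖ := by
        gcongr
        exact one_add_abs_le_mul_one_add_abs_div_add hl ha x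
    _ = ((1 + |l|) * (1 + R)) ^ n * ((1 + |x / l + a|) ^ n * ‖h (x / l + a)‖) := by
        rw [mul_pow _ (1 + |x / l + a|), mul_assoc]
    _ ≤ _ := by
        refine mul_le_mul_of_nonneg_left ?_ (by positivity)
        simpa using SchwartzMap.one_add_le_sup_seminorm_apply (𝕜 := ℂ) (m := (n, 0)) le_rfl le_rfl
          h (x / l + a)

/-- The `k`-th term of the Zak series `∑ₖ c k e^{2πikb} h (k / l + a)` at `p = (a, b)`. -/
def zakTerm (l : ℝ) (c : ℤ → ℂ) (h : 𝓢(ℝ, ℂ)) (p : ℝ × ℝ) (k : ℤ) : ℂ :=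
  c k * (𝐞 (k * p.2) * h (k / l + p.1))

/-- The sum of the Zak series with coefficients `c`. Its partial derivatives are Zak sums again:
differentiating in `a` replaces `h` by `h'`, and differentiating in `b` multiplies `c k` by
`2πik`. -/
def zakSum (l : ℝ) (c : ℤ → ℂ) (h : 𝓢(ℝ, ℂ)) (p : ℝ × ℝ) : ℂ := ∑' k, zakTerm l c h p k

section Zak

variable {l : ℝ} {c : ℤ → ℂ}

lemma exists_zakTerm_bound (hl : l ≠ 0) (hc : PolynomialGrowth c) (h : 𝓢(ℝ, ℂ)) (R : ℝ) :
    ∃ u : ℤ → ℝ, Summable u ∧ ∀ k, ∀ p : ℝ × ℝ, |p.1| ≤ R → ‖zakTerm l c h p k‖ ≤ u k := by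
  obtain ⟨C, n, hC⟩ := hc
  obtain ⟨D, hD⟩ := exists_sample_bound hl h (n + 2) R
  have hC0 : 0 ≤ C := by simpa using (norm_nonneg _).trans (hC 0)
  refine ⟨_, summable_inv_one_add_abs_sq.mul_left (C * D), fun k p hp => ?_⟩
  rw [← div_eq_mul_inv, le_div_iff₀ (by positivity)]
  calc ‖zakTerm l c h p k‖ * (1 + |(k : ℝ)|) ^ 2
      = ‖c k‖ * ‖h (k / l + p.1)‖ * (1 + |(k : ℝ)|) ^ 2 := by
        simp [zakTerm, Circle.norm_coe]
    _ ≤ C * (1 + |(k : ℝ)|) ^ n * ‖h (k / l + p.1)‖ * (1 + |(k : ℝ)|) ^ 2 := by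
        gcongr
        exact hC k
    _ = C * ((1 + |(k : ℝ)|) ^ (n + 2) * ‖h (k / l + p.1)‖) := by ring
    _ ≤ C * D := by
        gcongr
        exact hD k p.1 hp

lemma summable_zakTerm (hl : l ≠ 0) (hc : PolynomialGrowth c) (h : 𝓢(ℝ, ℂ)) (p : ℝ × ℝ) :
    Summable (zakTerm l c h p) := by
  obtain ⟨u, hu, hb⟩ := exists_zakTerm_bound hl hc h |p.1|
  exact .of_norm_bounded hu fun k => hb k p le_rfl

/-- The real differential on `ℝ × ℝ` with partial derivatives `z` and `w`. -/
def partials (z w : ℂ) : ℝ × ℝ →L[ℝ] ℂ :=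
  (ContinuousLinearMap.fst ℝ ℝ ℝ).smulRight z + (ContinuousLinearMap.snd ℝ ℝ ℝ).smulRight w

lemma partials_eq_smulRightL (z w : ℂ) : partials z w =
    ContinuousLinearMap.smulRightL ℝ (ℝ × ℝ) ℂ (ContinuousLinearMap.fst ℝ ℝ ℝ) z +
      ContinuousLinearMap.smulRightL ℝ (ℝ × ℝ) ℂ (ContinuousLinearMap.snd ℝ ℝ ℝ) w := rfl

lemma norm_partials_le (z w : ℂ) : ‖partials z w‖ ≤ ‖z‖ + ‖w‖ := by
  refine (norm_add_le _ _).trans ?_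
  rw [ContinuousLinearMap.norm_smulRight_apply, ContinuousLinearMap.norm_smulRight_apply]
  gcongr
  · exact mul_le_of_le_one_left (norm_nonneg _) (ContinuousLinearMap.norm_fst_le ℝ ℝ ℝ)
  · exact mul_le_of_le_one_left (norm_nonneg _) (ContinuousLinearMap.norm_snd_le ℝ ℝ ℝ)

lemma hasFDerivAt_zakTerm (l : ℝ) (c : ℤ → ℂ) (h : 𝓢(ℝ, ℂ)) (p : ℝ × ℝ) (k : ℤ) :
    HasFDerivAt (fun p => zakTerm l c h p k)
      (partials (zakTerm l c (SchwartzMap.derivCLM ℂ ℂ h) p k)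
        (zakTerm l (fun k => 2 * Real.pi * Complex.I * k * c k) h p k)) p := by
  have hchar : HasFDerivAt (fun p : ℝ × ℝ => (𝐞 (k * p.2) : ℂ)) _ p :=
    ((Real.hasDerivAt_fourierChar _).hasFDerivAt.comp p (hasFDerivAt_snd.const_mul (k : ℝ)))
  have hsample : HasFDerivAt (fun p : ℝ × ℝ => h (k / l + p.1)) _ p :=
    (h.differentiableAt (x := k / l + p.1)).hasDerivAt.comp_const_add _ _
      |>.hasFDerivAt.comp p hasFDerivAt_fst
  refine ((hchar.mul hsample).const_mul (c k)).congr_fderiv ?_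
  ext <;> simp [partials, zakTerm]
  ring

lemma hasFDerivAt_zakSum (hl : l ≠ 0) (hc : PolynomialGrowth c) (h : 𝓢(ℝ, ℂ)) (p : ℝ × ℝ) :
    HasFDerivAt (zakSum l c h) (partials (zakSum l c (SchwartzMap.derivCLM ℂ ℂ h) p)
      (zakSum l (fun k => 2 * Real.pi * Complex.I * k * c k) h p)) p := by
  have hc' := hc.intCast_mul (2 * Real.pi * Complex.I)
  obtain ⟨u, hu, hub⟩ := exists_zakTerm_bound hl hc (SchwartzMap.derivCLM ℂ ℂ h) (‖p‖ + 1)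
  obtain ⟨v, hv, hvb⟩ := exists_zakTerm_bound hl hc' h (‖p‖ + 1)
  have hp : p ∈ Metric.ball (0 : ℝ × ℝ) (‖p‖ + 1) := by simp
  refine (hasFDerivAt_tsum_of_isPreconnected (hu.add hv) Metric.isOpen_ball
    (convex_ball (0 : ℝ × ℝ) (‖p‖ + 1)).isPreconnected (fun k x _ => hasFDerivAt_zakTerm l c h x k)
    (fun k x hx => ?_) hp (summable_zakTerm hl hc h p) hp).congr_fderiv ?_
  · have hx1 : |x.1| ≤ ‖p‖ + 1 := (norm_fst_le x).trans (mem_ball_zero_iff.1 hx).le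
    exact (norm_partials_le _ _).trans (add_le_add (hub k x hx1) (hvb k x hx1))
  · simp only [partials_eq_smulRightL]
    exact ((ContinuousLinearMap.hasSum _ (summable_zakTerm hl hc _ p).hasSum).add
      (ContinuousLinearMap.hasSum _ (summable_zakTerm hl hc' h p).hasSum)).tsum_eq

theorem contDiff_zakSum (hl : l ≠ 0) (hc : PolynomialGrowth c) (h : 𝓢(ℝ, ℂ)) :
    ContDiff ℝ ∞ (zakSum l c h) := by
  refine contDiff_infty.2 fun m => ?_
  induction m generalizing h c with
  | zero => exact contDiff_zero.2 (continuous_iff_continuousAt.2 fun p =>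
      (hasFDerivAt_zakSum hl hc h p).continuousAt)
  | succ m ih =>
    push_cast
    rw [contDiff_succ_iff_fderiv]
    refine ⟨fun p => (hasFDerivAt_zakSum hl hc h p).differentiableAt, by simp, ?_⟩
    simp only [funext fun p => (hasFDerivAt_zakSum hl hc h p).fderiv, partials_eq_smulRightL]
    exact ((ContinuousLinearMap.contDiff _).comp (ih hc _)).add
      ((ContinuousLinearMap.contDiff _).comp (ih (hc.intCast_mul _) h))

end Zak

lemma bwzTerm_eq (l q : ℤ) (h : 𝓢(ℝ, ℂ)) (x : Heis) (k : ℤ) :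
    bwzTerm l q h x k = 𝐞 (l * x.c + k * x.b - q * (k / l)) * h (k / l + x.a) := by
  simp only [bwzTerm, coe_fourierChar, ← Complex.exp_add]
  congr 2
  push_cast
  ring

lemma bwzTerm_eq_zakTerm (l q : ℤ) (h : 𝓢(ℝ, ℂ)) (x : Heis) (k : ℤ) :
    bwzTerm l q h x k =
      𝐞 (l * x.c) * zakTerm l (fun k => 𝐞 (-(q * (k / l)))) h (x.a, x.b) k := by
  simp only [bwzTerm_eq, zakTerm, ← mul_assoc, fourierChar_mul_fourierChar]
  ring_nf

/-- The normalizing constant `√|l| / l` of the transform. -/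
def bwzConst (l : ℤ) : ℂ := ((Real.sqrt |(l : ℝ)| / l : ℝ) : ℂ)

lemma bwzLift_eq_tsum (l q : ℤ) (h : 𝓢(ℝ, ℂ)) (x : Heis) :
    bwzLift l q h x = bwzConst l * ∑' k, bwzTerm l q h x k := rfl

lemma bwzLift_eq_zakSum (l q : ℤ) (h : 𝓢(ℝ, ℂ)) (x : Heis) :
    bwzLift l q h x = bwzConst l *
      (𝐞 (l * x.c) * zakSum l (fun k => 𝐞 (-(q * (k / l)))) h (x.a, x.b)) := by
  simp only [bwzLift_eq_tsum, bwzTerm_eq_zakTerm, tsum_mul_left, zakSum]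

lemma bwzLift_eq_mul_of_shift {l q q' : ℤ} {h h' : 𝓢(ℝ, ℂ)} {x y : Heis} (z : ℂ) (m : ℤ)
    (H : ∀ k, bwzTerm l q h x k = z * bwzTerm l q' h' y (k + m)) :
    bwzLift l q h x = z * bwzLift l q' h' y := by
  rw [bwzLift_eq_tsum, bwzLift_eq_tsum, ← (Equiv.addRight m).tsum_eq (bwzTerm l q' h' y)]
  simp only [H, tsum_mul_left, Equiv.coe_addRight, mul_left_comm]

section Transform

variable {l : ℤ} (hl : l ≠ 0)
include hl

lemma summable_bwzTerm (q : ℤ) (h : 𝓢(ℝ, ℂ)) (x : Heis) : Summable (bwzTerm l q h x) := by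
  simp only [funext (bwzTerm_eq_zakTerm l q h x)]
  exact (summable_zakTerm (Int.cast_ne_zero.2 hl) (polynomialGrowth_fourierChar _) h _).mul_left _

lemma isPeriodic_bwzLift (q : ℤ) (h : 𝓢(ℝ, ℂ)) : IsPeriodic (bwzLift l q h) := by
  rintro _ ⟨m, n, p, rfl⟩ ⟨a, b, c⟩
  rw [← one_mul (bwzLift l q h ⟨a, b, c⟩)]
  refine bwzLift_eq_mul_of_shift 1 (l * m) fun k => ?_
  have hphase : 𝐞 (l * (p + c + m * b) + k * (n + b) - q * (k / l)) =
      𝐞 (l * c + (k + l * m : ℤ) * b - q * ((k + l * m : ℤ) / l)) :=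
    fourierChar_congr (l * p + k * n + q * m) (by push_cast; field_simp; ring)
  have hsample : ((k : ℝ) / l + (m + a)) = (k + l * m : ℤ) / l + a := by
    push_cast; field_simp; ring
  simp only [bwzTerm_eq, Heis.mul_a, Heis.mul_b, Heis.mul_c, hphase, hsample, one_mul]

lemma bwz_mk (q : ℤ) (h : 𝓢(ℝ, ℂ)) (x : Heis) : bwz l q h (mk x) = bwzLift l q h x :=
  onM_mk (isPeriodic_bwzLift hl q h) x

lemma smoothOnM_bwz (q : ℤ) (h : 𝓢(ℝ, ℂ)) : SmoothOnM (bwz l q h) := by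
  simp only [SmoothOnM, bwz_mk hl, bwzLift_eq_zakSum, Heis.ofProd]
  have hsum := contDiff_zakSum (Int.cast_ne_zero.2 hl)
    (polynomialGrowth_fourierChar fun k => -(q * (k / l))) h
  have hcentral : ContDiff ℝ ∞ fun p : ℝ × ℝ × ℝ => (𝐞 (l * p.2.2) : ℂ) :=
    contDiff_coe_fourierChar.comp (contDiff_const.mul (contDiff_snd.comp contDiff_snd))
  exact contDiff_const.mul (hcentral.mul
    (hsum.comp (contDiff_fst.prodMk (contDiff_fst.comp contDiff_snd))))

lemma bwz_mul_add (q m : ℤ) (h : 𝓢(ℝ, ℂ)) : bwz l (l * m + q) h = bwz l q h := by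
  funext y
  obtain ⟨x, rfl⟩ := mk_surjective y
  rw [bwz_mk hl, bwz_mk hl, ← one_mul (bwzLift l q h x)]
  refine bwzLift_eq_mul_of_shift 1 0 fun k => ?_
  have hphase : 𝐞 (l * x.c + k * x.b - (l * m + q : ℤ) * (k / l)) =
      𝐞 (l * x.c + k * x.b - q * (k / l)) :=
    fourierChar_congr (-(m * k)) (by push_cast; field_simp; ring)
  simp only [bwzTerm_eq, hphase, one_mul, add_zero]

lemma bwz_rmul_a (q₀ q : ℤ) (h : 𝓢(ℝ, ℂ)) (a b c : ℝ) :
    bwz l q₀ h (rmul ⟨q / l, 0, 0⟩ (mk ⟨a, b, c⟩)) =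
      𝐞 (-(q * b) + q₀ * (q / l)) * bwz l q₀ h (mk ⟨a, b, c⟩) := by
  rw [rmul_mk, bwz_mk hl, bwz_mk hl]
  refine bwzLift_eq_mul_of_shift _ q fun k => ?_
  simp only [bwzTerm_eq, Heis.mul_a, Heis.mul_b, Heis.mul_c, ← mul_assoc,
    fourierChar_mul_fourierChar]
  push_cast
  ring_nf

lemma bwz_rmul_b (q₀ q : ℤ) (h : 𝓢(ℝ, ℂ)) (a b c : ℝ) :
    bwz l q₀ h (rmul ⟨0, q / l, 0⟩ (mk ⟨a, b, c⟩)) =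
      𝐞 (q * a) * bwz l (q₀ - q) h (mk ⟨a, b, c⟩) := by
  rw [rmul_mk, bwz_mk hl, bwz_mk hl]
  refine bwzLift_eq_mul_of_shift _ 0 fun k => ?_
  have hphase : l * (c + a * (q / l)) + k * (b + q / l) - q₀ * (k / l) =
      q * a + (l * c + k * b - (q₀ - q : ℤ) * ((k : ℝ) / l)) := by
    push_cast; field_simp; ring
  simp only [bwzTerm_eq, Heis.mul_a, Heis.mul_b, Heis.mul_c, ← mul_assoc,
    fourierChar_mul_fourierChar, hphase, add_zero]

end Transform

lemma iteratedDeriv_fourierChar (n : ℕ) : iteratedDeriv n (fun x : ℝ => (𝐞 x : ℂ)) =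
    fun x => (2 * Real.pi * Complex.I) ^ n * 𝐞 x := by
  induction n with
  | zero => simp
  | succ n ih =>
    ext x
    rw [iteratedDeriv_succ, ih, ((Real.hasDerivAt_fourierChar x).const_mul _).deriv]
    ring

lemma hasTemperateGrowth_fourierChar : Function.HasTemperateGrowth fun x : ℝ => (𝐞 x : ℂ) := by
  refine ⟨contDiff_coe_fourierChar, fun n => ⟨0, (2 * Real.pi) ^ n, fun x => ?_⟩⟩
  rw [norm_iteratedFDeriv_eq_norm_iteratedDeriv, iteratedDeriv_fourierChar]
  simp [Circle.norm_coe, abs_of_pos Real.pi_pos]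

/-- The Schrödinger action on Schwartz functions. -/
def schwartzSchrodinger (l : ℝ) (g : Heis) (h : 𝓢(ℝ, ℂ)) : 𝓢(ℝ, ℂ) :=
  SchwartzMap.smulLeftCLM ℂ (fun u : ℝ => (𝐞 (l * (g.c + u * g.b)) : ℂ))
    (SchwartzMap.compSubConstCLM ℂ (-g.a) h)

lemma schwartzSchrodinger_apply (l : ℝ) (g : Heis) (h : 𝓢(ℝ, ℂ)) (u : ℝ) :
    schwartzSchrodinger l g h u = 𝐞 (l * (g.c + u * g.b)) * h (u + g.a) := by
  have hg : (fun u : ℝ => (𝐞 (l * (g.c + u * g.b)) : ℂ)).HasTemperateGrowth :=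
    hasTemperateGrowth_fourierChar.comp (f := fun u : ℝ => l * (g.c + u * g.b)) (by fun_prop)
  rw [schwartzSchrodinger, SchwartzMap.smulLeftCLM_apply_apply hg,
    SchwartzMap.compSubConstCLM_apply, sub_neg_eq_add, smul_eq_mul]

lemma toLp_schwartzSchrodinger (l : ℝ) (g : Heis) (h : 𝓢(ℝ, ℂ)) :
    (schwartzSchrodinger l g h).toLp 2 volume = schrodinger l g (h.toLp 2 volume) := by
  refine Lp.ext ?_
  filter_upwards [coeFn_schrodinger l g (h.toLp 2 volume), h.coeFn_toLp 2 volume,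
    (schwartzSchrodinger l g h).coeFn_toLp 2 volume,
    (measurePreserving_add_right volume g.a).quasiMeasurePreserving.ae (h.coeFn_toLp 2 volume)]
    with u hu _ hg hgu
  rw [hu, hg, hgu, schwartzSchrodinger_apply, phase_eq]

lemma bwz_schwartzSchrodinger {l : ℤ} (hl : l ≠ 0) (q : ℤ) (g : Heis) (h : 𝓢(ℝ, ℂ)) (m : M) :
    bwz l q (schwartzSchrodinger l g h) m = bwz l q h (rmul g m) := by
  obtain ⟨⟨a, b, c⟩, rfl⟩ := mk_surjective m
  rw [rmul_mk, bwz_mk hl, bwz_mk hl, ← one_mul (bwzLift l q h _)]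
  refine bwzLift_eq_mul_of_shift 1 0 fun k => ?_
  have hphase : l * c + k * b - q * (k / l) + l * (g.c + (k / l + a) * g.b) =
      l * (c + g.c + a * g.b) + k * (b + g.b) - q * ((k : ℝ) / l) := by
    field_simp; ring
  simp only [bwzTerm_eq, schwartzSchrodinger_apply, Heis.mul_a, Heis.mul_b, Heis.mul_c,
    ← mul_assoc, fourierChar_mul_fourierChar, hphase, one_mul, add_zero, add_assoc]

/-! ### The isometry on `L²(ℝ)` -/

section LpSeries

variable {X ι E : Type*} [MeasurableSpace X] {μ : Measure X} [Countable ι] [NormedAddCommGroup E]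
  [CompleteSpace E] {p : ℝ≥0∞} [Fact (1 ≤ p)]

lemma hasSum_toLp {v : ι → X → E} {F : X → E} (hv : ∀ k, MemLp (v k) p μ) (hF : MemLp F p μ)
    (hsum : Summable fun k => ‖(hv k).toLp‖) (hFv : F =ᵐ[μ] fun x => ∑' k, v k x) :
    HasSum (fun k => (hv k).toLp) hF.toLp := by
  have h : ∑' k, (hv k).toLp = hF.toLp := by
    refine Lp.ext ?_
    filter_upwards [Lp.coeFn_tsum (tsum_enorm_ne_top_iff_summable_norm.2 hsum), hF.coeFn_toLp, hFv,
      ae_all_iff.2 fun k => (hv k).coeFn_toLp] with x hx hFx hFvx hvx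
    simp only [hx, hFx, hFvx, hvx]
  exact h ▸ hsum.of_norm.hasSum

end LpSeries

section Pythagoras

variable {𝕜 E ι : Type*} [RCLike 𝕜] [NormedAddCommGroup E] [InnerProductSpace 𝕜 E]

lemma hasSum_norm_sq_of_orthogonal {v : ι → E} {S : E} (hS : HasSum v S)
    (hv : Pairwise fun i j => inner 𝕜 (v i) (v j) = 0) :
    HasSum (fun i => ‖v i‖ ^ 2) (‖S‖ ^ 2) := by
  have hcoeff (i : ι) : inner 𝕜 (v i) S = inner 𝕜 (v i) (v i) :=
    ((innerSL 𝕜 (v i)).hasSum hS).unique (hasSum_single i fun j hj => hv hj.symm)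
  have hre : HasSum (fun i => RCLike.re (inner 𝕜 S (v i))) (RCLike.re (inner 𝕜 S S)) :=
    RCLike.reCLM.hasSum ((innerSL 𝕜 S).hasSum hS)
  simpa only [inner_re_symm S, hcoeff, inner_self_eq_norm_sq] using hre

lemma norm_sq_eq_integral_of_inner_self_eq {X : Type*} [MeasurableSpace X] {μ : Measure X}
    {x : E} {φ : X → 𝕜} (h : inner 𝕜 x x = ∫ t, inner 𝕜 (φ t) (φ t) ∂μ) :
    ‖x‖ ^ 2 = ∫ t, ‖φ t‖ ^ 2 ∂μ := by
  simp only [inner_self_eq_norm_sq_to_K, ← RCLike.ofReal_pow, integral_ofReal] at h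
  exact RCLike.ofReal_injective h

end Pythagoras

section Unfolding

variable {E : Type*} [NormedAddCommGroup E] [NormedSpace ℝ E] {F : ℝ → E}

lemma hasSum_integral_translates (hF : Integrable F) (y : ℝ) :
    HasSum (fun m : ℤ => ∫ a, F (y + m + a) ∂unitMeasure) (∫ x, F x) := by
  have h (m : ℤ) : ∫ a, F (y + m + a) ∂unitMeasure = ∫ x in y + m..y + m + 1, F x := by
    rw [unitMeasure, integral_Ico_eq_integral_Ioc,
      ← intervalIntegral.integral_of_le zero_le_one,
      intervalIntegral.integral_comp_add_left F (y + m), add_zero]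
  simpa only [h] using hF.hasSum_intervalIntegral y

variable [CompleteSpace E]

lemma tsum_integral_samples_natCast {n : ℕ} [NeZero n] (hF : Integrable F)
    (hs : Summable fun k : ℤ => ∫ a, F ((k : ℝ) / n + a) ∂unitMeasure) :
    ∑' k : ℤ, ∫ a, F ((k : ℝ) / n + a) ∂unitMeasure = n • ∫ x, F x := by
  let e : ℤ ≃ Fin n × ℤ := (Int.divModEquiv n).trans (Equiv.prodComm _ _)
  have hn : (n : ℝ) ≠ 0 := NeZero.ne _
  have he (r : Fin n) (m : ℤ) : ((e.symm (r, m) : ℤ) : ℝ) / n = (r : ℕ) / n + m := by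
    simp only [e, Equiv.symm_trans_apply, Equiv.prodComm_symm, Equiv.prodComm_apply, Prod.swap,
      Int.divModEquiv_symm_apply]
    push_cast
    field_simp
    ring
  rw [← e.symm.tsum_eq]
  refine (e.symm.summable_iff.2 hs).tsum_prod.trans ?_
  simp only [Function.comp_apply, he, (hasSum_integral_translates hF _).tsum_eq, tsum_fintype,
    Finset.sum_const, Finset.card_univ, Fintype.card_fin]

lemma tsum_integral_samples {l : ℤ} (hl : l ≠ 0) (hF : Integrable F)
    (hs : Summable fun k : ℤ => ∫ a, F ((k : ℝ) / l + a) ∂unitMeasure) :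
    ∑' k : ℤ, ∫ a, F ((k : ℝ) / l + a) ∂unitMeasure = l.natAbs • ∫ x, F x := by
  have : NeZero l.natAbs := ⟨Int.natAbs_ne_zero.2 hl⟩
  obtain h | h := l.natAbs_eq
  · rw [h] at hs ⊢
    exact tsum_integral_samples_natCast hF hs
  · have hneg (k : ℤ) : ((-k : ℤ) : ℝ) / l = k / l.natAbs := by
      rw [h]; push_cast; rw [neg_div_neg_eq]; simp
    rw [← (Equiv.neg ℤ).summable_iff] at hs
    rw [← (Equiv.neg ℤ).tsum_eq]
    simp only [Function.comp_def, Equiv.neg_apply, hneg] at hs ⊢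
    exact tsum_integral_samples_natCast hF hs

end Unfolding

/-- The samples of `h` occurring in the `k`-th term of the transform, as a function of `a`. -/
def bwzSample (l q : ℤ) (h : 𝓢(ℝ, ℂ)) (k : ℤ) (a : ℝ) : ℂ := 𝐞 (-(q * (k / l))) * h (k / l + a)

lemma norm_bwzSample (l q : ℤ) (h : 𝓢(ℝ, ℂ)) (k : ℤ) (a : ℝ) :
    ‖bwzSample l q h k a‖ = ‖h (k / l + a)‖ := by
  rw [bwzSample, norm_mul, Circle.norm_coe, one_mul]

lemma continuous_bwzSample (l q : ℤ) (h : 𝓢(ℝ, ℂ)) (k : ℤ) : Continuous (bwzSample l q h k) :=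
  continuous_const.mul (h.continuous.comp (continuous_const.add continuous_id))

lemma cubeMode_bwzSample (l q : ℤ) (h : 𝓢(ℝ, ℂ)) (k : ℤ) (m : M) :
    cubeMode (bwzSample l q h k) k l m = bwzTerm l q h (rep m) k := by
  rw [cubeMode, bwzSample, bwzTerm_eq, mul_right_comm, fourierChar_mul_fourierChar]
  ring_nf

lemma norm_bwzConst_sq_mul {l : ℤ} (hl : l ≠ 0) : ‖bwzConst l‖ ^ 2 * |(l : ℝ)| = 1 := by
  have hl0 : 0 < |(l : ℝ)| := abs_pos.2 (Int.cast_ne_zero.2 hl)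
  rw [bwzConst, Complex.norm_real, Real.norm_eq_abs, sq_abs, div_pow, Real.sq_sqrt hl0.le,
    ← sq_abs (l : ℝ)]
  field_simp

section Isometry

variable {l : ℤ} (hl : l ≠ 0)
include hl

lemma exists_bwzSample_bound (q : ℤ) (h : 𝓢(ℝ, ℂ)) :
    ∃ u : ℤ → ℝ, Summable u ∧ ∀ k, ∀ a ∈ Set.Ico (0 : ℝ) 1, ‖bwzSample l q h k a‖ ≤ u k := by
  obtain ⟨u, hu, hb⟩ := exists_zakTerm_bound (Int.cast_ne_zero.2 hl)
    (polynomialGrowth_fourierChar fun _ => 0) h 1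
  refine ⟨u, hu, fun k a ha => ?_⟩
  simpa [norm_bwzSample, zakTerm, Circle.norm_coe] using hb k (a, 0) (by
    rw [abs_of_nonneg ha.1]
    exact ha.2.le)

lemma memLp_bwzSample (q : ℤ) (h : 𝓢(ℝ, ℂ)) (k : ℤ) :
    MemLp (cubeMode (bwzSample l q h k) k l) 2 muM := by
  obtain ⟨u, -, hu⟩ := exists_bwzSample_bound hl q h
  exact memLp_cubeMode (continuous_bwzSample l q h k).measurable k l (hu k) 2

lemma bwz_eq_tsum (q : ℤ) (h : 𝓢(ℝ, ℂ)) (m : M) :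
    bwz l q h m = bwzConst l * ∑' k, cubeMode (bwzSample l q h k) k l m := by
  simp only [cubeMode_bwzSample, ← bwzLift_eq_tsum, ← bwz_mk hl, mk_rep]

lemma measurable_bwz (q : ℤ) (h : 𝓢(ℝ, ℂ)) : Measurable (bwz l q h) := by
  have hsmooth : ContDiff ℝ ∞ fun p : ℝ × ℝ × ℝ => bwz l q h (mk (Heis.ofProd p)) :=
    smoothOnM_bwz hl q h
  have heq (x : Heis) : Heis.ofProd (Heis.equivProd x) = x := rfl
  have hlift : Measurable fun x : Heis => bwz l q h (mk x) := by
    simpa only [Function.comp_def, heq] using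
      hsmooth.continuous.measurable.comp Heis.measurable_equivProd
  exact fun _ hs => hlift hs

lemma memLp_bwz (q : ℤ) (h : 𝓢(ℝ, ℂ)) : MemLp (bwz l q h) 2 muM := by
  obtain ⟨u, hu, hb⟩ := exists_bwzSample_bound hl q h
  refine .of_bound (measurable_bwz hl q h).aestronglyMeasurable (‖bwzConst l‖ * ∑' k, u k)
    (.of_forall fun m => ?_)
  rw [bwz_eq_tsum hl, norm_mul]
  gcongr
  refine tsum_of_norm_bounded hu.hasSum fun k => ?_
  rw [norm_cubeMode]
  exact hb k _ (rep_mem_cube m).1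

lemma bwz_mem_centralMode (q : ℤ) (h : 𝓢(ℝ, ℂ)) : (memLp_bwz hl q h).toLp ∈ centralMode l :=
  mem_centralMode_iff.2 ⟨_, MemLp.coeFn_toLp _, fun a b c => by
    simp only [bwz_mk hl, bwzLift_eq_zakSum, mul_zero, AddChar.map_zero_eq_one, Circle.coe_one]
    ring⟩

lemma norm_cubeMode_bwzSample_sq (q : ℤ) (h : 𝓢(ℝ, ℂ)) (k : ℤ) :
    ‖(memLp_bwzSample hl q h k).toLp‖ ^ 2 = ∫ a, ‖h (k / l + a)‖ ^ 2 ∂unitMeasure := by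
  simp only [← norm_bwzSample l q]
  refine norm_sq_eq_integral_of_inner_self_eq (𝕜 := ℂ) ?_
  simp only [inner_cubeMode_cubeMode, if_true, mul_one, RCLike.inner_apply']

lemma hasSum_bwz (q : ℤ) (h : 𝓢(ℝ, ℂ)) :
    HasSum (fun k => bwzConst l • (memLp_bwzSample hl q h k).toLp) (memLp_bwz hl q h).toLp := by
  obtain ⟨u, hu, hb⟩ := exists_bwzSample_bound hl q h
  have hnorm (k : ℤ) : ‖((memLp_bwzSample hl q h k).const_smul (bwzConst l)).toLp‖ ≤
      ‖bwzConst l‖ * u k := by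
    rw [MemLp.toLp_const_smul _ (memLp_bwzSample hl q h k), norm_smul]
    gcongr
    have hu0 : 0 ≤ u k := (norm_nonneg _).trans (hb k 0 (by simp))
    refine (Lp.norm_le_of_ae_bound hu0 ?_).trans_eq (by simp [measureUnivNNReal])
    filter_upwards [(memLp_bwzSample hl q h k).coeFn_toLp] with m hm
    rw [hm, norm_cubeMode]
    exact hb k _ (rep_mem_cube m).1
  exact hasSum_toLp (fun k => (memLp_bwzSample hl q h k).const_smul (bwzConst l)) _
    (.of_nonneg_of_le (fun _ => norm_nonneg _) hnorm (hu.mul_left _))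
    (.of_forall fun m => by simp only [bwz_eq_tsum hl, Pi.smul_apply, smul_eq_mul, tsum_mul_left])

lemma norm_bwz_toLp (q : ℤ) (h : 𝓢(ℝ, ℂ)) :
    ‖(memLp_bwz hl q h).toLp‖ = ‖h.toLp 2 volume‖ := by
  have hnorm := hasSum_norm_sq_of_orthogonal (𝕜 := ℂ) (hasSum_bwz hl q h) fun i j hij => by
    simp only [inner_smul_left, inner_smul_right, inner_cubeMode_cubeMode, if_neg hij, zero_mul,
      mul_zero]
  simp only [norm_smul, mul_pow, norm_cubeMode_bwzSample_sq hl] at hnorm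
  have hc : ‖bwzConst l‖ ^ 2 ≠ 0 := left_ne_zero_of_mul_eq_one (norm_bwzConst_sq_mul hl)
  have hint : Integrable fun x => ‖h x‖ ^ 2 :=
    (h.memLp 2 volume).integrable_norm_pow two_ne_zero
  refine (pow_left_inj₀ (norm_nonneg _) (norm_nonneg _) two_ne_zero).1 ?_
  calc ‖(memLp_bwz hl q h).toLp‖ ^ 2
      = ‖bwzConst l‖ ^ 2 * ∑' k : ℤ, ∫ a, ‖h (k / l + a)‖ ^ 2 ∂unitMeasure := by
        rw [← hnorm.tsum_eq, tsum_mul_left]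
    _ = ‖bwzConst l‖ ^ 2 * (l.natAbs • ∫ x, ‖h x‖ ^ 2) := by
        rw [tsum_integral_samples (F := fun x => ‖h x‖ ^ 2) hl hint
          ((summable_mul_left_iff hc).1 hnorm.summable)]
    _ = ∫ x, ‖h x‖ ^ 2 := by
        rw [nsmul_eq_mul, Nat.cast_natAbs, Int.cast_abs, ← mul_assoc, norm_bwzConst_sq_mul hl,
          one_mul]
    _ = ‖h.toLp 2 volume‖ ^ 2 :=
        (norm_sq_eq_integral_of_inner_self_eq (h.inner_toL2_toL2_eq h volume)).symm

end Isometry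

section IsometricExtension

variable {𝕜 S E F : Type*} [NontriviallyNormedField 𝕜] [AddCommGroup S] [Module 𝕜 S]
  [NormedAddCommGroup E] [NormedSpace 𝕜 E] [NormedAddCommGroup F] [NormedSpace 𝕜 F]
  [CompleteSpace F] {T : S →ₗ[𝕜] F} {e : S →ₗ[𝕜] E}

lemma extendOfNorm_apply_of_norm_eq (he : DenseRange e) (hT : ∀ s, ‖T s‖ = ‖e s‖) (s : S) :
    T.extendOfNorm e (e s) = T s :=
  LinearMap.extendOfNorm_eq he ⟨1, fun s => by rw [one_mul, hT]⟩ s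

/-- The extension along a map `e` with dense range of a linear map `T` which is isometric for the
norm pulled back by `e`. -/
def isometricExtension (he : DenseRange e) (hT : ∀ s, ‖T s‖ = ‖e s‖) : E →ₗᵢ[𝕜] F where
  toLinearMap := (T.extendOfNorm e).toLinearMap
  norm_map' x := he.induction_on (p := fun x => ‖T.extendOfNorm e x‖ = ‖x‖) x
    (isClosed_eq (T.extendOfNorm e).continuous.norm continuous_norm) fun s => by
      rw [extendOfNorm_apply_of_norm_eq he hT, hT]

lemma isometricExtension_apply (he : DenseRange e) (hT : ∀ s, ‖T s‖ = ‖e s‖) (s : S) :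
    isometricExtension he hT (e s) = T s :=
  extendOfNorm_apply_of_norm_eq he hT s

end IsometricExtension

lemma denseRange_schwartz_toLp : DenseRange fun h : 𝓢(ℝ, ℂ) => (h.toLp 2 volume : L2R) :=
  SchwartzMap.denseRange_toLpCLM (F := ℂ) (p := 2) (μ := (volume : Measure ℝ)) (by norm_num)

lemma eq_of_eq_on_schwartz {X : Type*} [TopologicalSpace X] [T2Space X] {S T : L2R → X}
    (hS : Continuous S) (hT : Continuous T)
    (h : ∀ φ : 𝓢(ℝ, ℂ), S (φ.toLp 2 volume) = T (φ.toLp 2 volume)) (f : L2R) : S f = T f :=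
  congrFun (denseRange_schwartz_toLp.equalizer hS hT (funext h)) f

section Extension

variable {l : ℤ} (hl : l ≠ 0) (q : ℤ)
include hl

lemma bwz_add (h h' : 𝓢(ℝ, ℂ)) : bwz l q (h + h') = bwz l q h + bwz l q h' := by
  funext m
  obtain ⟨x, rfl⟩ := mk_surjective m
  simp only [Pi.add_apply, bwz_mk hl, bwzLift_eq_tsum]
  rw [← mul_add, ← (summable_bwzTerm hl q h x).tsum_add (summable_bwzTerm hl q h' x)]
  simp only [bwzTerm, add_apply, mul_add]

lemma bwz_smul (z : ℂ) (h : 𝓢(ℝ, ℂ)) : bwz l q (z • h) = z • bwz l q h := by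
  funext m
  obtain ⟨x, rfl⟩ := mk_surjective m
  simp only [Pi.smul_apply, smul_eq_mul, bwz_mk hl, bwzLift_eq_tsum, bwzTerm,
    smul_apply, mul_left_comm _ z, tsum_mul_left]

/-- The transform as a linear map from the Schwartz space to `L²(M)`. -/
def bwzLinear : 𝓢(ℝ, ℂ) →ₗ[ℂ] L2M where
  toFun h := (memLp_bwz hl q h).toLp
  map_add' h h' := by simp only [bwz_add hl, MemLp.toLp_add (memLp_bwz hl q h) (memLp_bwz hl q h')]
  map_smul' z h := by
    simp only [bwz_smul hl, MemLp.toLp_const_smul z (memLp_bwz hl q h), RingHom.id_apply]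

/-- The isometric extension of the transform to `L²(ℝ)`. -/
def bwzIso : L2R →ₗᵢ[ℂ] L2M :=
  isometricExtension (T := bwzLinear hl q)
    (e := (SchwartzMap.toLpCLM ℂ ℂ 2 (volume : Measure ℝ)).toLinearMap)
    denseRange_schwartz_toLp (norm_bwz_toLp hl q)

lemma bwzIso_toLp (h : 𝓢(ℝ, ℂ)) : bwzIso hl q (h.toLp 2 volume) = (memLp_bwz hl q h).toLp :=
  isometricExtension_apply (T := bwzLinear hl q)
    (e := (SchwartzMap.toLpCLM ℂ ℂ 2 (volume : Measure ℝ)).toLinearMap)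
    denseRange_schwartz_toLp (norm_bwz_toLp hl q) h

theorem coeFn_bwzIso_toLp (h : 𝓢(ℝ, ℂ)) :
    (bwzIso hl q (h.toLp 2 volume) : M → ℂ) =ᵐ[muM] bwz l q h := by
  rw [bwzIso_toLp]
  exact MemLp.coeFn_toLp _

theorem bwzIso_unique (T : L2R →L[ℂ] L2M)
    (hT : ∀ h : 𝓢(ℝ, ℂ), (T (h.toLp 2 volume) : M → ℂ) =ᵐ[muM] bwz l q h) :
    T = (bwzIso hl q).toContinuousLinearMap :=
  ContinuousLinearMap.ext (eq_of_eq_on_schwartz T.continuous (bwzIso hl q).continuous fun h =>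
    Lp.ext ((hT h).trans (coeFn_bwzIso_toLp hl q h).symm))

lemma bwzIso_mul_add (m : ℤ) : bwzIso hl (l * m + q) = bwzIso hl q :=
  LinearIsometry.ext <| eq_of_eq_on_schwartz (bwzIso hl _).continuous (bwzIso hl q).continuous
    fun h => by simp only [bwzIso_toLp, bwz_mul_add hl]

theorem bwzIso_mem (f : L2R) : bwzIso hl q f ∈ centralMode l :=
  denseRange_schwartz_toLp.induction_on (p := fun f => bwzIso hl q f ∈ centralMode l) f
    ((isClosed_centralMode l).preimage (bwzIso hl q).continuous) fun h => by
      rw [bwzIso_toLp]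
      exact bwz_mem_centralMode hl q h

lemma coeFn_regRep_bwzIso_toLp (g : Heis) (h : 𝓢(ℝ, ℂ)) :
    (regRep g (bwzIso hl q (h.toLp 2 volume)) : M → ℂ) =ᵐ[muM] fun m => bwz l q h (rmul g m) :=
  (coeFn_regRep g _).trans
    ((mp_rmul g).quasiMeasurePreserving.ae_eq_comp (coeFn_bwzIso_toLp hl q h))

theorem bwzIso_schrodinger (g : Heis) (f : L2R) :
    bwzIso hl q (schrodinger l g f) = regRep g (bwzIso hl q f) := by
  refine eq_of_eq_on_schwartz ((bwzIso hl q).continuous.comp (schrodinger l g).continuous)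
    ((regRep g).continuous.comp (bwzIso hl q).continuous) (fun h => Lp.ext ?_) f
  simp only [← toLp_schwartzSchrodinger, Function.comp_apply]
  filter_upwards [coeFn_bwzIso_toLp hl q (schwartzSchrodinger l g h),
    coeFn_regRep_bwzIso_toLp hl q g h] with m hm hreg
  rw [hm, hreg, bwz_schwartzSchrodinger hl]

end Extension

/-! ### Orthogonality and completeness of the ranges -/

section UnimodularMultiplication

variable {X : Type*} [MeasurableSpace X] {μ : Measure X} {p : ℝ≥0∞} {φ : X → ℂ}

lemma memLp_unimodular_mul (hφ : AEStronglyMeasurable φ μ) (hφ₁ : ∀ x, ‖φ x‖ = 1)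
    (f : Lp ℂ p μ) : MemLp (fun x => φ x * (f : X → ℂ) x) p μ :=
  (Lp.memLp f).of_le (hφ.mul (Lp.aestronglyMeasurable f)) (.of_forall fun x => by simp [hφ₁])

/-- Multiplication by a function of modulus one, as an isometry of `Lᵖ`. -/
def unimodularMul [Fact (1 ≤ p)] (hφ : AEStronglyMeasurable φ μ) (hφ₁ : ∀ x, ‖φ x‖ = 1) :
    Lp ℂ p μ →ₗᵢ[ℂ] Lp ℂ p μ where
  toFun f := (memLp_unimodular_mul hφ hφ₁ f).toLp
  map_add' f f' := by
    rw [← MemLp.toLp_add, MemLp.toLp_eq_toLp_iff]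
    filter_upwards [Lp.coeFn_add f f'] with x hx
    rw [hx, Pi.add_apply, Pi.add_apply, mul_add]
  map_smul' z f := by
    rw [RingHom.id_apply, ← MemLp.toLp_const_smul, MemLp.toLp_eq_toLp_iff]
    filter_upwards [Lp.coeFn_smul z f] with x hx
    rw [hx, Pi.smul_apply, Pi.smul_apply, mul_smul_comm]
  norm_map' f := by
    refine (Lp.norm_toLp _ (memLp_unimodular_mul hφ hφ₁ f)).trans (congrArg ENNReal.toReal ?_)
    exact eLpNorm_congr_norm_ae (.of_forall fun x => by simp [hφ₁])

lemma coeFn_unimodularMul [Fact (1 ≤ p)] (hφ : AEStronglyMeasurable φ μ)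
    (hφ₁ : ∀ x, ‖φ x‖ = 1) (f : Lp ℂ p μ) :
    (unimodularMul hφ hφ₁ f : X → ℂ) =ᵐ[μ] fun x => φ x * (f : X → ℂ) x :=
  (memLp_unimodular_mul hφ hφ₁ f).coeFn_toLp

end UnimodularMultiplication

lemma norm_chi (w : ℤ × ℤ) (m : M) : ‖chi w m‖ = 1 := by
  rw [chi_eq_cubeMode, norm_cubeMode, Circle.norm_coe]

/-- Multiplication by the character `χ_w` on `L²(M)`. -/
def mulChi (w : ℤ × ℤ) : L2M →ₗᵢ[ℂ] L2M :=
  unimodularMul ((Lp.aestronglyMeasurable _).congr (coeFn_chiLp w)) (norm_chi w)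

lemma coeFn_mulChi (w : ℤ × ℤ) (f : L2M) :
    (mulChi w f : M → ℂ) =ᵐ[muM] fun m => chi w m * (f : M → ℂ) m :=
  coeFn_unimodularMul _ _ f

section Translation

variable {l : ℤ} (hl : l ≠ 0) (q₀ q : ℤ)
include hl

lemma mulChi_regRep_bwzIso (f : L2R) :
    mulChi (0, q) (regRep ⟨q / l, 0, 0⟩ (bwzIso hl q₀ f)) =
      (𝐞 (q₀ * (q / l)) : ℂ) • bwzIso hl q₀ f := by
  refine eq_of_eq_on_schwartz
    ((mulChi _).continuous.comp ((regRep _).continuous.comp (bwzIso hl q₀).continuous))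
    ((bwzIso hl q₀).continuous.const_smul (𝐞 (q₀ * (q / l)) : ℂ)) (fun h => Lp.ext ?_) f
  filter_upwards [coeFn_mulChi (0, q) (regRep ⟨q / l, 0, 0⟩ (bwzIso hl q₀ (h.toLp 2 volume))),
    coeFn_regRep_bwzIso_toLp hl q₀ ⟨q / l, 0, 0⟩ h, coeFn_bwzIso_toLp hl q₀ h,
    Lp.coeFn_smul (𝐞 (q₀ * (q / l)) : ℂ) (bwzIso hl q₀ (h.toLp 2 volume))]
    with m hmul hreg hbwz hsmul
  obtain ⟨x, rfl⟩ := mk_surjective m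
  simp only [Function.comp_apply, hmul, hreg, hsmul, Pi.smul_apply, hbwz, smul_eq_mul]
  rw [bwz_rmul_a hl, ← mul_assoc, chi_mk, chiLift_eq, fourierChar_mul_fourierChar]
  congr 4
  push_cast
  ring

lemma regRep_bwzIso_eq_mulChi (f : L2R) :
    regRep ⟨0, q / l, 0⟩ (bwzIso hl q₀ f) = mulChi (q, 0) (bwzIso hl (q₀ - q) f) := by
  refine eq_of_eq_on_schwartz ((regRep _).continuous.comp (bwzIso hl q₀).continuous)
    ((mulChi _).continuous.comp (bwzIso hl (q₀ - q)).continuous) (fun h => Lp.ext ?_) f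
  filter_upwards [coeFn_mulChi (q, 0) (bwzIso hl (q₀ - q) (h.toLp 2 volume)),
    coeFn_regRep_bwzIso_toLp hl q₀ ⟨0, q / l, 0⟩ h, coeFn_bwzIso_toLp hl (q₀ - q) h]
    with m hmul hreg hbwz
  obtain ⟨x, rfl⟩ := mk_surjective m
  simp only [Function.comp_apply, hmul, hreg, hbwz]
  rw [bwz_rmul_b hl, chi_mk, chiLift_eq, Int.cast_zero, zero_mul, add_zero]

lemma ae_bwzIso_translate_a (f : L2R) :
    ∀ᵐ m ∂muM, chi (0, q) m * (bwzIso hl q₀ f : M → ℂ) (rmul ⟨q / l, 0, 0⟩ m) =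
      𝐞 (q₀ * (q / l)) * (bwzIso hl q₀ f : M → ℂ) m := by
  have h := coeFn_mulChi (0, q) (regRep ⟨q / l, 0, 0⟩ (bwzIso hl q₀ f))
  rw [mulChi_regRep_bwzIso] at h
  filter_upwards [h, coeFn_regRep ⟨q / l, 0, 0⟩ (bwzIso hl q₀ f),
    Lp.coeFn_smul (𝐞 (q₀ * (q / l)) : ℂ) (bwzIso hl q₀ f)] with m hmul hreg hsmul
  rw [← hreg, ← hmul, hsmul, Pi.smul_apply, smul_eq_mul]

lemma ae_bwzIso_translate_b (f : L2R) :
    ∀ᵐ m ∂muM, (bwzIso hl q₀ f : M → ℂ) (rmul ⟨0, q / l, 0⟩ m) =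
      chi (q, 0) m * (bwzIso hl (q₀ - q) f : M → ℂ) m := by
  have h := coeFn_regRep ⟨0, q / l, 0⟩ (bwzIso hl q₀ f)
  rw [regRep_bwzIso_eq_mulChi] at h
  exact h.symm.trans (coeFn_mulChi (q, 0) _)

end Translation

section FiniteFourier

variable {l : ℤ} (hl : l ≠ 0)
include hl

lemma fourierChar_div_eq_one_iff {m : ℤ} : 𝐞 (m / l) = 1 ↔ l ∣ m := by
  rw [fourierChar_eq_one_iff]
  refine exists_congr fun n => ?_
  rw [div_eq_iff (Int.cast_ne_zero.2 hl), mul_comm]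
  norm_cast

lemma sum_range_fourierChar (m : ℤ) :
    ∑ q ∈ Finset.range l.natAbs, (𝐞 (q * (m / l)) : ℂ) = if l ∣ m then (l.natAbs : ℂ) else 0 := by
  have hpow (q : ℕ) : (𝐞 (q * (m / l)) : ℂ) = (𝐞 (m / l) : ℂ) ^ q := by
    rw [← nsmul_eq_mul, AddChar.map_nsmul_eq_pow, Circle.coe_pow]
  have hroot : (𝐞 (m / l) : ℂ) ^ l.natAbs = 1 := by
    have hl₀ : (l : ℝ) ≠ 0 := Int.cast_ne_zero.2 hl
    have habs : (l.natAbs : ℝ) = l.sign * l := by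
      rw [Nat.cast_natAbs, ← Int.sign_mul_self_eq_abs, Int.cast_mul]
    rw [← hpow, Circle.coe_eq_one, fourierChar_eq_one_iff]
    exact ⟨l.sign * m, by rw [habs]; push_cast; field_simp⟩
  simp only [hpow]
  split_ifs with hdvd
  · simp [(fourierChar_div_eq_one_iff hl).2 hdvd]
  · have hne : (𝐞 (m / l) : ℂ) ≠ 1 := by
      rwa [Ne, Circle.coe_eq_one, fourierChar_div_eq_one_iff hl]
    rw [geom_sum_eq hne, hroot, sub_self, zero_div]

end FiniteFourier

section Coefficient

/-- The Fourier coefficient of index `(k, l)` of `f` in the variables `b` and `c`, as a function of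
`a ∈ [0, 1)`. -/
def cubeCoeff (k l : ℤ) (f : L2M) (a : ℝ) : ℂ :=
  ∫ p : ℝ × ℝ, starRingEnd ℂ (𝐞 (k * p.1 + l * p.2)) * (f : M → ℂ) (toM (a, p))
    ∂(unitMeasure.prod unitMeasure)

lemma integrable_cubeCoeff (k l : ℤ) (f : L2M) : Integrable (cubeCoeff k l f) unitMeasure := by
  have h := (integrable_conj_cubeMode_mul (memLp_cubeMode_fourierChar 0 k l) f).integral_prod_left
  simp only [Int.cast_zero, zero_mul, AddChar.map_zero_eq_one, Circle.coe_one, one_mul] at h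
  exact h

lemma inner_cubeMode_eq_integral_cubeCoeff {φ : ℝ → ℂ} {k l : ℤ}
    (hφ : MemLp (cubeMode φ k l) 2 muM) (f : L2M) :
    inner ℂ hφ.toLp f = ∫ a, starRingEnd ℂ (φ a) * cubeCoeff k l f a ∂unitMeasure := by
  rw [inner_cubeMode, integral_prod _ (integrable_conj_cubeMode_mul hφ f)]
  simp only [map_mul, mul_assoc, integral_const_mul, cubeCoeff]

end Coefficient

section Decomposition

variable {l : ℤ} (hl : l ≠ 0)
include hl

lemma inner_bwzIso {q q' : ℤ} (h : ¬ l ∣ q - q') (f f' : L2R) :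
    inner ℂ (bwzIso hl q f) (bwzIso hl q' f') = 0 := by
  let T : L2M →ₗᵢ[ℂ] L2M :=
    (mulChi (0, 1)).comp (regRep ⟨(1 : ℤ) / l, 0, 0⟩).toLinearIsometry
  have hT (q : ℤ) (f : L2R) : T (bwzIso hl q f) = (𝐞 (q / l) : ℂ) • bwzIso hl q f := by
    change mulChi (0, 1) (regRep ⟨(1 : ℤ) / l, 0, 0⟩ (bwzIso hl q f)) = _
    simpa only [Int.cast_one, mul_one_div] using mulChi_regRep_bwzIso hl q 1 f
  have hne : (𝐞 (q / l) : ℂ) ≠ 𝐞 (q' / l) := fun heq => h <| by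
    rw [← fourierChar_div_eq_one_iff hl, Int.cast_sub, sub_div, AddChar.map_sub_eq_div,
      Circle.ext heq, div_self']
  exact inner_eq_zero_of_eigenvector T hne (hT q f) (hT q' f')

lemma sum_fourierChar_mul_bwz (k₀ : ℤ) (h : 𝓢(ℝ, ℂ)) (x : Heis) :
    ∑ q ∈ Finset.range l.natAbs, (𝐞 (q * (k₀ / l)) : ℂ) * bwz l q h (mk x) =
      bwzConst l * ∑' k : ℤ, (if l ∣ k₀ - k then (l.natAbs : ℂ) else 0) *
        (𝐞 (l * x.c + k * x.b) * h (k / l + x.a)) := by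
  have hterm (q : ℕ) (k : ℤ) : (𝐞 (q * (k₀ / l)) : ℂ) * bwzTerm l q h x k =
      𝐞 (q * ((k₀ - k : ℤ) / l)) * (𝐞 (l * x.c + k * x.b) * h (k / l + x.a)) := by
    rw [bwzTerm_eq, ← mul_assoc, ← mul_assoc, fourierChar_mul_fourierChar,
      fourierChar_mul_fourierChar]
    congr 3
    push_cast
    ring
  have hsum (q : ℕ) : Summable fun k : ℤ =>
      𝐞 (q * ((k₀ - k : ℤ) / l)) * (𝐞 (l * x.c + k * x.b) * h (k / l + x.a)) := by
    simpa only [hterm] using (summable_bwzTerm hl q h x).mul_left (𝐞 (q * (k₀ / l)) : ℂ)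
  simp only [bwz_mk hl, bwzLift_eq_tsum, mul_left_comm _ (bwzConst l),
    ← tsum_mul_left (a := (𝐞 _ : ℂ)), hterm]
  rw [← Finset.mul_sum, ← Summable.tsum_finsetSum fun q _ => hsum q]
  simp only [← Finset.sum_mul, sum_range_fourierChar hl]

/-- Among the samples of a function supported in `k₀ / l + (0, 1)` at the points `k / l + a` with
`k ≡ k₀` modulo `l`, only the one with `k = k₀` is nonzero. -/
lemma sum_fourierChar_mul_bwz_of_support (k₀ : ℤ) {h : 𝓢(ℝ, ℂ)}
    (hh : ∀ a, a ∉ Set.Ioo (0 : ℝ) 1 → h (k₀ / l + a) = 0) (m : M) :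
    ∑ q ∈ Finset.range l.natAbs, (𝐞 (q * (k₀ / l)) : ℂ) * bwz l q h m =
      bwzConst l * l.natAbs * cubeMode (fun a => h (k₀ / l + a)) k₀ l m := by
  have hl₀ : (l : ℝ) ≠ 0 := Int.cast_ne_zero.2 hl
  obtain ⟨ha₀, ha₁⟩ := (rep_mem_cube m).1
  conv_lhs => rw [← mk_rep m]
  rw [sum_fourierChar_mul_bwz hl, tsum_eq_single k₀, sub_self, if_pos (dvd_zero l), cubeMode]
  · ring_nf
  · intro k hk
    split_ifs with hdvd
    · obtain ⟨j, hj⟩ := hdvd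
      have hj₀ : j ≠ 0 := by
        rintro rfl
        exact hk (by linarith)
      have hk' : (k : ℝ) / l + (rep m).a = k₀ / l + ((rep m).a - j) := by
        rw [show k = k₀ - l * j by linarith]
        push_cast
        field_simp
        ring
      rw [hk', hh _ fun hmem => hj₀ ?_, mul_zero, mul_zero]
      have h₁ : (-1 : ℝ) < j := by linarith [hmem.2]
      have h₂ : (j : ℝ) < 1 := by linarith [hmem.1]
      norm_cast at h₁ h₂
      lia
    · rw [zero_mul]

variable {f : L2M}

lemma inner_cubeMode_eq_zero
    (hf : ∀ (q : ℤ) (h : 𝓢(ℝ, ℂ)), inner ℂ (memLp_bwz hl q h).toLp f = 0) (k : ℤ) {h : 𝓢(ℝ, ℂ)}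
    (hh : ∀ a, a ∉ Set.Ioo (0 : ℝ) 1 → h (k / l + a) = 0)
    (hm : MemLp (cubeMode (fun a => h (k / l + a)) k l) 2 muM) : inner ℂ hm.toLp f = 0 := by
  have hc : bwzConst l * (l.natAbs : ℂ) ≠ 0 := by
    refine mul_ne_zero (fun h₀ => ?_) (Nat.cast_ne_zero.2 (Int.natAbs_ne_zero.2 hl))
    simpa [h₀] using norm_bwzConst_sq_mul hl
  have hsum : ∑ q ∈ Finset.range l.natAbs, (𝐞 (q * (k / l)) : ℂ) • (memLp_bwz hl q h).toLp =
      (bwzConst l * l.natAbs) • hm.toLp := by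
    refine Lp.ext ((Lp.coeFn_fun_finsetSum _ _).trans ?_)
    have hterm (q : ℕ) : ⇑((𝐞 (q * (k / l)) : ℂ) • (memLp_bwz hl q h).toLp) =ᵐ[muM]
        fun m => (𝐞 (q * (k / l)) : ℂ) * bwz l q h m :=
      (Lp.coeFn_smul _ _).trans ((memLp_bwz hl q h).coeFn_toLp.const_smul _)
    filter_upwards [ae_all_iff.2 hterm, (Lp.coeFn_smul (bwzConst l * l.natAbs) hm.toLp).trans
      (hm.coeFn_toLp.const_smul _)] with m hL hR
    simp only [hL, hR, sum_fourierChar_mul_bwz_of_support hl k hh m, Pi.smul_apply, smul_eq_mul]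
  have hinner : inner ℂ ((bwzConst l * l.natAbs) • hm.toLp) f = 0 := by
    simp only [← hsum, sum_inner, inner_smul_left, hf, mul_zero, Finset.sum_const_zero]
  rw [inner_smul_left] at hinner
  exact (mul_eq_zero.1 hinner).resolve_left ((map_ne_zero _).2 hc)

lemma ae_cubeCoeff_eq_zero
    (hf : ∀ (q : ℤ) (h : 𝓢(ℝ, ℂ)), inner ℂ (memLp_bwz hl q h).toLp f = 0) (k : ℤ) :
    ∀ᵐ a ∂unitMeasure, cubeCoeff k l f a = 0 := by
  have hIoo : ∀ᵐ a ∂unitMeasure, a ∈ Set.Ioo (0 : ℝ) 1 := by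
    rw [unitMeasure, ← restrict_Ioo_eq_restrict_Ico]
    exact ae_restrict_mem measurableSet_Ioo
  suffices h : ∀ᵐ a ∂unitMeasure, a ∈ Set.Ioo (0 : ℝ) 1 → cubeCoeff k l f a = 0 by
    filter_upwards [h, hIoo] with a ha hmem using ha hmem
  refine isOpen_Ioo.ae_eq_zero_of_integral_contDiff_smul_eq_zero
    ((integrable_cubeCoeff k l f).locallyIntegrable.locallyIntegrableOn _) fun g hg hgc hgs => ?_
  have hgc' : HasCompactSupport fun x => (g x : ℂ) := hgc.comp_left Complex.ofReal_zero
  have hg' : ContDiff ℝ ∞ fun x => (g x : ℂ) := Complex.ofRealCLM.contDiff.comp hg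
  let h : 𝓢(ℝ, ℂ) := SchwartzMap.compSubConstCLM ℂ ((k : ℝ) / l) (hgc'.toSchwartzMap hg')
  have hhg (a : ℝ) : h (k / l + a) = g a := congrArg (fun x => (g x : ℂ)) (add_sub_cancel_left _ a)
  have hh (a : ℝ) (ha : a ∉ Set.Ioo (0 : ℝ) 1) : h (k / l + a) = 0 := by
    rw [hhg, image_eq_zero_of_notMem_tsupport fun hmem => ha (hgs hmem), Complex.ofReal_zero]
  obtain ⟨C, hC⟩ := hgc'.exists_bound_of_continuous hg'.continuous
  have hm : MemLp (cubeMode (fun a => h (k / l + a)) k l) 2 muM :=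
    memLp_cubeMode (by fun_prop) k l (fun a _ => by rw [hhg]; exact hC a) 2
  calc ∫ a, g a • cubeCoeff k l f a ∂unitMeasure
      = ∫ a, starRingEnd ℂ (h (k / l + a)) * cubeCoeff k l f a ∂unitMeasure := by
        simp only [hhg, Complex.conj_ofReal, Complex.real_smul]
    _ = inner ℂ hm.toLp f := (inner_cubeMode_eq_integral_cubeCoeff hm f).symm
    _ = 0 := inner_cubeMode_eq_zero hl hf k hh hm

lemma eq_zero_of_orthogonal_bwz (hfl : f ∈ centralMode l)
    (hf : ∀ (q : ℤ) (h : 𝓢(ℝ, ℂ)), inner ℂ (memLp_bwz hl q h).toLp f = 0) : f = 0 := by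
  refine eq_zero_of_mem_centralMode hfl fun j k => ?_
  rw [inner_cubeMode_eq_integral_cubeCoeff]
  exact integral_eq_zero_of_ae <| (ae_cubeCoeff_eq_zero hl hf k).mono fun a ha => by simp [ha]

/-- `bwzIso hl q` for a residue `q` modulo `l`, through the representative `q.cast : ℤ`. -/
def bwzMod (q : ZMod l.natAbs) : L2R →ₗᵢ[ℂ] L2M :=
  bwzIso hl (q.cast : ℤ)

lemma bwzMod_intCast (q : ℤ) : bwzMod hl q = bwzIso hl q := by
  rw [bwzMod, ZMod.coe_intCast, ← bwzIso_mul_add hl _ (q / l), Int.natCast_natAbs, Int.emod_abs,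
    Int.mul_ediv_add_emod]

theorem isOrthogonalDecomposition_bwzMod :
    IsOrthogonalDecomposition (fun q => LinearMap.range (bwzMod hl q).toLinearMap)
      (centralMode l) := by
  refine .of_total (fun q => (bwzMod hl q).isometry.isClosedEmbedding.isClosed_range)
    (isClosed_centralMode l) ?_ ?_ fun f hfl hf => eq_zero_of_orthogonal_bwz hl hfl fun q h => ?_
  · rintro q _ ⟨f, rfl⟩
    exact bwzIso_mem hl _ f
  · intro q q' hqq'
    refine (Submodule.isOrtho_iff_inner_eq).2 ?_
    rintro _ ⟨f, rfl⟩ _ ⟨f', rfl⟩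
    refine inner_bwzIso hl (fun hdvd => hqq' ?_) f f'
    rw [← ZMod.intCast_zmod_cast q, ← ZMod.intCast_zmod_cast q']
    exact ((ZMod.intCast_eq_intCast_iff_dvd_sub _ _ _).2 (Int.natAbs_dvd.2 hdvd)).symm
  · have hrange : (memLp_bwz hl q h).toLp ∈
        LinearMap.range (bwzMod hl (q : ZMod l.natAbs)).toLinearMap :=
      ⟨h.toLp 2, by rw [LinearIsometry.coe_toLinearMap, bwzMod_intCast, bwzIso_toLp]⟩
    exact (Submodule.mem_orthogonal _ _).1 (hf q) _ hrange

theorem isInvariant_range_bwzMod (q : ZMod l.natAbs) :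
    IsInvariant regRep (LinearMap.range (bwzMod hl q).toLinearMap) := by
  rintro g _ ⟨f, rfl⟩
  exact ⟨schrodinger l g f, bwzIso_schrodinger hl _ g f⟩

end Decomposition

section TranslationFormulas

variable {l : ℤ} (hl : l ≠ 0) (q₀ q : ℤ)

lemma exp_neg_eq_fourierChar (t : ℝ) :
    Complex.exp (-(2 * Real.pi * Complex.I * q * t)) = 𝐞 (-(q * t)) := by
  rw [coe_fourierChar]
  push_cast
  ring_nf

lemma exp_eq_fourierChar (t : ℝ) :
    Complex.exp (2 * Real.pi * Complex.I * q * t) = 𝐞 (q * t) := by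
  rw [coe_fourierChar]
  push_cast
  ring_nf

include hl

theorem bwz_translate (h : 𝓢(ℝ, ℂ)) (a b c : ℝ) :
    bwz l q₀ h (rmul ⟨q / l, 0, 0⟩ (mk ⟨a, b, c⟩)) =
      Complex.exp (-(2 * Real.pi * Complex.I * q * b)) *
        Complex.exp (2 * Real.pi * Complex.I * q₀ * (q / l)) * bwz l q₀ h (mk ⟨a, b, c⟩) ∧
    bwz l q₀ h (rmul ⟨0, q / l, 0⟩ (mk ⟨a, b, c⟩)) =
      Complex.exp (2 * Real.pi * Complex.I * q * a) * bwz l (q₀ - q) h (mk ⟨a, b, c⟩) := by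
  have hdiv := exp_eq_fourierChar q₀ (q / l)
  push_cast at hdiv
  rw [hdiv, exp_neg_eq_fourierChar, exp_eq_fourierChar, fourierChar_mul_fourierChar]
  exact ⟨bwz_rmul_a hl q₀ q h a b c, bwz_rmul_b hl q₀ q h a b c⟩

theorem ae_bwzMod_translate (f : L2R) :
    ∀ᵐ p : ℝ × ℝ × ℝ,
      (bwzMod hl q₀ f : M → ℂ) (rmul ⟨q / l, 0, 0⟩ (mk ⟨p.1, p.2.1, p.2.2⟩)) =
        Complex.exp (-(2 * Real.pi * Complex.I * q * p.2.1)) *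
          Complex.exp (2 * Real.pi * Complex.I * q₀ * (q / l)) *
            (bwzMod hl q₀ f : M → ℂ) (mk ⟨p.1, p.2.1, p.2.2⟩) ∧
      (bwzMod hl q₀ f : M → ℂ) (rmul ⟨0, q / l, 0⟩ (mk ⟨p.1, p.2.1, p.2.2⟩)) =
        Complex.exp (2 * Real.pi * Complex.I * q * p.1) *
          (bwzMod hl ((q₀ - q : ℤ) : ZMod l.natAbs) f : M → ℂ) (mk ⟨p.1, p.2.1, p.2.2⟩) := by
  have hdiv := exp_eq_fourierChar q₀ (q / l)
  push_cast at hdiv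
  simp only [bwzMod_intCast, hdiv, exp_neg_eq_fourierChar, exp_eq_fourierChar]
  filter_upwards [ae_toM (ae_bwzIso_translate_a hl q₀ q f),
    ae_toM (ae_bwzIso_translate_b hl q₀ q f)] with ⟨a, b, c⟩ ha hb
  simp only [toM, Heis.ofProd, chi_mk, chiLift_eq, Int.cast_zero, zero_mul, zero_add,
    add_zero] at ha hb
  refine ⟨?_, hb⟩
  rw [mul_assoc, ← ha, ← mul_assoc, fourierChar_mul_fourierChar, neg_add_cancel,
    AddChar.map_zero_eq_one, Circle.coe_one, one_mul]

end TranslationFormulas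

end HeisNil

end

theorem theorem2p1 :
    -- the orthogonal decomposition of `L²(M)` into central Fourier modes, stable under `R`,
    -- whose components are given by Fourier series in the central variable
    IsOrthogonalDecomposition centralMode ⊤ ∧
    (∀ l : ℤ, IsInvariant regRep (centralMode l)) ∧
    (∀ f : L2M, ∃ F : ℤ → L2M,
      (∀ l : ℤ, F l ∈ centralMode l ∧
        ∀ᵐ p : ℝ × ℝ × ℝ,
          IntervalIntegrable (fun t : ℝ => (f : M → ℂ) (mk ⟨p.1, p.2.1, t⟩)) volume 0 1 ∧
          (F l : M → ℂ) (mk ⟨p.1, p.2.1, p.2.2⟩) =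
            Complex.exp (2 * Real.pi * Complex.I * l * p.2.2) *
              ∫ t in (0 : ℝ)..1, (f : M → ℂ) (mk ⟨p.1, p.2.1, t⟩) *
                Complex.exp (-(2 * Real.pi * Complex.I * l * t))) ∧
      HasSum F f) ∧
    -- (1) the zero mode
    ((∀ w : ℤ × ℤ, IsPeriodic (chiLift w) ∧ (∀ x : Heis, chi w (mk x) = chiLift w x) ∧
        SmoothOnM (chi w)) ∧
      ∃ X : ℤ × ℤ → L2M,
        (∀ w : ℤ × ℤ, (X w : M → ℂ) =ᵐ[muM] chi w) ∧
        IsOrthogonalDecomposition (fun w => Submodule.span ℂ {X w}) (centralMode 0) ∧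
        ∀ w : ℤ × ℤ, IsIrreducibleOn regRep (Submodule.span ℂ {X w})) ∧
    ∀ l : ℤ, l ≠ 0 →
      -- (2a) the transform is well defined, smooth, in the mode `l`, and periodic in `q`
      (∀ (q : ℤ) (h : 𝓢(ℝ, ℂ)),
        (∀ x : Heis, Summable (bwzTerm l q h x)) ∧
        IsPeriodic (bwzLift l q h) ∧
        (∀ x : Heis, bwz l q h (mk x) = bwzLift l q h x) ∧
        SmoothOnM (bwz l q h) ∧
        (∃ hL : MemLp (bwz l q h) 2 muM, hL.toLp ∈ centralMode l) ∧
        ∀ k : ℤ, bwz l (l * k + q) h = bwz l q h) ∧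
      -- (2c) the translation formulas
      (∀ (q₀ q : ℤ) (h : 𝓢(ℝ, ℂ)) (a b c : ℝ),
        bwz l q₀ h (rmul ⟨q / l, 0, 0⟩ (mk ⟨a, b, c⟩)) =
          Complex.exp (-(2 * Real.pi * Complex.I * q * b)) *
            Complex.exp (2 * Real.pi * Complex.I * q₀ * (q / l)) * bwz l q₀ h (mk ⟨a, b, c⟩) ∧
        bwz l q₀ h (rmul ⟨0, q / l, 0⟩ (mk ⟨a, b, c⟩)) =
          Complex.exp (2 * Real.pi * Complex.I * q * a) * bwz l (q₀ - q) h (mk ⟨a, b, c⟩)) ∧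
      -- the Schrödinger representation is irreducible
      IsIrreducibleOn (schrodinger l) ⊤ ∧
      -- (2b) the isometric extensions to `L²(ℝ)`, indexed by `ℤ/lℤ`
      ∃ B : ZMod l.natAbs → (L2R →ₗᵢ[ℂ] L2M),
        (∀ q : ℤ,
          (∀ h : 𝓢(ℝ, ℂ), (B q (h.toLp 2) : M → ℂ) =ᵐ[muM] bwz l q h) ∧
          ∀ T : L2R →L[ℂ] L2M,
            (∀ h : 𝓢(ℝ, ℂ), (T (h.toLp 2) : M → ℂ) =ᵐ[muM] bwz l q h) →
              T = (B q).toContinuousLinearMap) ∧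
        (∀ q f, B q f ∈ centralMode l) ∧
        -- (2c) for the extensions
        (∀ (q₀ q : ℤ) (f : L2R), ∀ᵐ p : ℝ × ℝ × ℝ,
          (B q₀ f : M → ℂ) (rmul ⟨q / l, 0, 0⟩ (mk ⟨p.1, p.2.1, p.2.2⟩)) =
            Complex.exp (-(2 * Real.pi * Complex.I * q * p.2.1)) *
              Complex.exp (2 * Real.pi * Complex.I * q₀ * (q / l)) *
                (B q₀ f : M → ℂ) (mk ⟨p.1, p.2.1, p.2.2⟩) ∧
          (B q₀ f : M → ℂ) (rmul ⟨0, q / l, 0⟩ (mk ⟨p.1, p.2.1, p.2.2⟩)) =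
            Complex.exp (2 * Real.pi * Complex.I * q * p.1) *
              (B ((q₀ - q : ℤ) : ZMod l.natAbs) f : M → ℂ) (mk ⟨p.1, p.2.1, p.2.2⟩)) ∧
        -- (3) the ranges decompose the mode `l`, and `B q` intertwines `R` with `π_l`
        IsOrthogonalDecomposition (fun q => LinearMap.range (B q).toLinearMap)
          (centralMode l) ∧
        (∀ q, IsInvariant regRep (LinearMap.range (B q).toLinearMap)) ∧
        ∀ q g f, B q (schrodinger l g f) = regRep g (B q f) := by
  refine ⟨isOrthogonalDecomposition_centralMode, isInvariant_centralMode, ?centralSeries,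
    ⟨?characters, chiLp, coeFn_chiLp, isOrthogonalDecomposition_chiLp, isIrreducibleOn_chiLp⟩,
    fun l hl => ⟨?schwartz, bwz_translate hl, isIrreducibleOn_schrodinger (Int.cast_ne_zero.2 hl),
      bwzMod hl, ?extension, fun q => bwzIso_mem hl _, ae_bwzMod_translate hl,
      isOrthogonalDecomposition_bwzMod hl, isInvariant_range_bwzMod hl,
      fun q => bwzIso_schrodinger hl _⟩⟩
  case centralSeries =>
    exact fun f => ⟨fun l => centralProj l f,
      fun l => ⟨centralProj_mem l f, ae_centralProj_eq l f⟩, hasSum_centralProj f⟩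
  case characters =>
    exact fun w => ⟨isPeriodic_chiLift w, chi_mk w, smoothOnM_chi w⟩
  case schwartz =>
    exact fun q h => ⟨summable_bwzTerm hl q h, isPeriodic_bwzLift hl q h, bwz_mk hl q h,
      smoothOnM_bwz hl q h, ⟨memLp_bwz hl q h, bwz_mem_centralMode hl q h⟩,
      fun k => bwz_mul_add hl q k h⟩
  case extension =>
    intro q
    rw [bwzMod_intCast]
    exact ⟨coeFn_bwzIso_toLp hl q, bwzIso_unique hl q⟩
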